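/- Let $G=\mathrm{PGL}_2(\mathbb{R})$, let $\Gamma=\mathrm{PGL}_2(\mathbb{Z})$ be viewed as a subgroup of $G$, let $X=\Gamma\backslash G$ and $H=\{h_t=\mathrm{diag}(e^{t/2},e^{-t/2}) : t\in\mathbb{R}\}$, acting on $X$ by right translation (the geodesic flow $x\mapsto x h_t$). An orbit $xH$ is *periodic* if $xh_T=x$ for some $T>0$; its length $\mathrm{vol}(xH)$ is the least such $T$. Let $\mathfrak g=M_2(\mathbb{R})/\mathbb{R}\cdot 1$ be the Lie algebra of $G$, let $\mathfrak g_{\mathbb Z}$ be the image of $M_2(\mathbb{Z})$ in $\mathfrak g$, let $B(x,y)=2\,\mathrm{tr}(xy)-\mathrm{tr}(x)\,\mathrm{tr}(y)$, let $V_{\mathbb Z}\subset\mathfrak g\otimes\mathfrak g$ be the additive group generated by all $x\otimes y$ with $x,y\in\mathfrak g_{\mathbb Z}$, and let $\mathfrak h\subset\mathfrak g$ be the image of the diagonal matrices. The *discriminant* $\mathrm{disc}(\Gamma gH)$ of a periodic orbit is the least positive integer $n$ such that $n\,\dfrac{w\otimes w}{B(w,w)}\in V_{\mathbb Z}$, where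 $w$ is any nonzero element of $\mathrm{Ad}(g)\mathfrak h$. For $\delta>0$ let $$\Omega'_\delta=\{\Gamma g\in X : \|mg\|_\infty^2\ge\delta\,|\det g| \text{ for all nonzero row vectors } m\in\mathbb{Z}^2\}.$$ **Theorem.** For every $\varepsilon>0$ there is a $\delta>0$ such that the set $\Omega'_\delta$ is compact, for every real $\Delta$ only finitely many periodic $H$-orbits contained in $\Omega'_\delta$ have discriminant at most $\Delta$, and there are constants $c>0$ and $\Delta_0$ (depending on $\varepsilon$ and $\delta$) such that for all $\Delta\ge\Delta_0$ $$\sum_{\substack{Y\subset\Omega'_\delta \text{ a periodic } H\text{-orbit}\\ \mathrm{disc}(Y)\le\Delta}}\mathrm{vol}(Y)\ \ge\ c\,\Delta^{1-\varepsilon}.$$ -/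

import Mathlib

open Matrix
open scoped MatrixGroups TensorProduct

noncomputable section

namespace PGL2Geodesic

/-! ### The space `X = PGL₂(ℤ) \ PGL₂(ℝ)` -/

/-- The quotient topology on `PGL₂(ℝ) = GL₂(ℝ) / centre`. -/
instance instTopologicalSpacePGL : TopologicalSpace PGL(2, ℝ) :=
  TopologicalSpace.coinduced (ProjGenLinGroup.mk : GL (Fin 2) ℝ →* PGL(2, ℝ)) inferInstance

/-- `Γ = PGL₂(ℤ)`, viewed as a subgroup of `PGL₂(ℝ)`. -/
def Gam : Subgroup PGL(2, ℝ) :=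
  (ProjGenLinGroup.map (n := Fin 2) (Int.castRingHom ℝ)).range

/-- `X = Γ \ PGL₂(ℝ)`, the space of cosets `Γ g`, with the quotient topology. -/
abbrev X : Type := Quotient (QuotientGroup.rightRel Gam)

/-- The coset `Γ g`. -/
def coset (g : PGL(2, ℝ)) : X := Quotient.mk _ g

/-- Right translation `Γ g ↦ Γ g a` on `X`. -/
def translate (x : X) (a : PGL(2, ℝ)) : X :=
  Quotient.map (fun g => g * a)
    (fun g₁ g₂ h => by
      change QuotientGroup.rightRel Gam _ _ at h
      change QuotientGroup.rightRel Gam _ _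
      rw [QuotientGroup.rightRel_apply] at h ⊢
      simpa [mul_assoc] using h) x

/-! ### The geodesic flow and its periodic orbits -/

/-- The matrix `diag(e^{t/2}, e^{-t/2})` in `GL₂(ℝ)`. -/
def geodesicMatrix (t : ℝ) : GL (Fin 2) ℝ :=
  GeneralLinearGroup.mkOfDetNeZero !![Real.exp (t / 2), 0; 0, Real.exp (-t / 2)]
    (by simp [Matrix.det_fin_two])

/-- The geodesic flow on `X`: right translation by the class of `diag(e^{t/2}, e^{-t/2})`. -/
def flow (t : ℝ) (x : X) : X := translate x (ProjGenLinGroup.mk (geodesicMatrix t))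

/-- The orbit `x H`, where `H = {diag(e^{t/2}, e^{-t/2}) : t ∈ ℝ}`. -/
def orbit (x : X) : Set X := Set.range fun t : ℝ => flow t x

/-- `Y ⊆ X` is a periodic orbit of the geodesic flow. -/
def IsPeriodicOrbit (Y : Set X) : Prop :=
  ∃ x : X, Y = orbit x ∧ ∃ T : ℝ, 0 < T ∧ flow T x = x

/-- The length (volume) of a periodic orbit `Y`: its least positive period, that is, the covolume
of the common stabilizer `{t : flow t y = y}` of the points `y ∈ Y`. -/
def length (Y : Set X) : ℝ := sInf {T : ℝ | 0 < T ∧ ∀ y ∈ Y, flow T y = y}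

/-! ### The Lie algebra and the discriminant -/

/-- The scalar matrices in `M₂(ℝ)`. -/
def scalars : Submodule ℝ (Matrix (Fin 2) (Fin 2) ℝ) := Submodule.span ℝ {1}

/-- The Lie algebra of `PGL₂(ℝ)`: the quotient of `M₂(ℝ)` by the scalar matrices. -/
abbrev LieAlg : Type := Matrix (Fin 2) (Fin 2) ℝ ⧸ scalars

/-- The integral lattice in the Lie algebra: the image of `M₂(ℤ)`. -/
def latticeZ : Set LieAlg :=
  Set.range fun M : Matrix (Fin 2) (Fin 2) ℤ => scalars.mkQ (M.map (Int.cast : ℤ → ℝ))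

/-- The form `(A, B) ↦ 2 tr(AB) - tr(A) tr(B)` on `M₂(ℝ)`. -/
def traceForm :
    Matrix (Fin 2) (Fin 2) ℝ →ₗ[ℝ] Matrix (Fin 2) (Fin 2) ℝ →ₗ[ℝ] ℝ :=
  LinearMap.mk₂ ℝ (fun A B => 2 * (A * B).trace - A.trace * B.trace)
    (by intro A A' B; simp [add_mul]; ring)
    (by intro c A B; simp; ring)
    (by intro A B B'; simp [mul_add]; ring)
    (by intro c A B; simp; ring)

/-- The invariant form on the Lie algebra induced by `(A, B) ↦ 2 tr(AB) - tr(A) tr(B)`. -/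
def form : LieAlg →ₗ[ℝ] LieAlg →ₗ[ℝ] ℝ :=
  traceForm.liftQ₂ scalars scalars
    (by
      rw [scalars, Submodule.span_le, Set.singleton_subset_iff]
      simp only [SetLike.mem_coe, LinearMap.mem_ker]
      ext1 B
      simp [traceForm])
    (by
      rw [scalars, Submodule.span_le, Set.singleton_subset_iff]
      simp only [SetLike.mem_coe, LinearMap.mem_ker]
      ext1 B
      simp [traceForm]; ring)

/-- Conjugation `A ↦ g A g⁻¹` on `M₂(ℝ)`. -/
def conjMatrix (g : GL (Fin 2) ℝ) :
    Matrix (Fin 2) (Fin 2) ℝ →ₗ[ℝ] Matrix (Fin 2) (Fin 2) ℝ :=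
  LinearMap.mulLeft ℝ (g : Matrix (Fin 2) (Fin 2) ℝ) ∘ₗ
    LinearMap.mulRight ℝ ((g⁻¹ : GL (Fin 2) ℝ) : Matrix (Fin 2) (Fin 2) ℝ)

/-- The adjoint action `Ad(g)` on the Lie algebra. -/
def Ad (g : GL (Fin 2) ℝ) : LieAlg →ₗ[ℝ] LieAlg :=
  scalars.mapQ scalars (conjMatrix g)
    (by
      rw [scalars, Submodule.span_le, Set.singleton_subset_iff]
      have h : conjMatrix g 1 = 1 := by
        simp only [conjMatrix, LinearMap.comp_apply, LinearMap.mulLeft_apply,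
          LinearMap.mulRight_apply, one_mul]
        exact Units.mul_inv g
      simp only [Submodule.comap_coe, Set.mem_preimage, SetLike.mem_coe, h]
      exact Submodule.subset_span rfl)

/-- The Cartan subalgebra `𝔥`: the image of the diagonal matrices. -/
def cartan : Submodule ℝ LieAlg :=
  Submodule.map scalars.mkQ (LinearMap.range (Matrix.diagonalLinearMap (Fin 2) ℝ ℝ))

/-- The integral structure on `V = 𝔤 ⊗ 𝔤`: the additive group generated by the tensors `x ⊗ y`
with `x`, `y` in the integral lattice of `𝔤`. (The rank of `PGL₂` is `r = 1`, so that the `r`-th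
exterior power of `𝔤` is `𝔤` itself.) -/
def tensorLatticeZ : AddSubgroup (LieAlg ⊗[ℝ] LieAlg) :=
  AddSubgroup.closure {v | ∃ x ∈ latticeZ, ∃ y ∈ latticeZ, v = x ⊗ₜ[ℝ] y}

/-- The discriminant of a Cartan subalgebra `𝔱`: the least positive integer `n` such that `n ι(𝔱)`
is integral, where `ι(𝔱) = (w ⊗ w) / B(w, w)` for any nonzero `w ∈ 𝔱`. -/
def cartanDisc (𝔱 : Submodule ℝ LieAlg) : ℕ :=
  sInf {n : ℕ | 0 < n ∧
    ∀ w ∈ 𝔱, w ≠ 0 → (n : ℝ) • ((form w w)⁻¹ • (w ⊗ₜ[ℝ] w)) ∈ tensorLatticeZ}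

/-- The discriminant of a periodic orbit `Y = Γ g H`: the discriminant of `Ad(g) 𝔥`, which is the
same for all `g` with `Γ g ∈ Y`. -/
def disc (Y : Set X) : ℕ :=
  sInf {n : ℕ | ∃ g : GL (Fin 2) ℝ,
    coset (ProjGenLinGroup.mk g) ∈ Y ∧ n = cartanDisc (Submodule.map (Ad g) cartan)}

/-! ### The sets `Ω'_δ` -/

/-- `Ω'_δ`: the cosets `Γ g` such that `‖m g‖² ≥ δ |det g|` for all nonzero row vectors `m ∈ ℤ²`,
where `‖·‖` is the maximum norm on `ℝ²`. -/
def Omega (δ : ℝ) : Set X :=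
  {x | ∀ g : GL (Fin 2) ℝ, x = coset (ProjGenLinGroup.mk g) →
    ∀ m : Fin 2 → ℤ, m ≠ 0 →
      δ * |(g : Matrix (Fin 2) (Fin 2) ℝ).det| ≤
        ‖(fun i => (m i : ℝ)) ᵥ* (g : Matrix (Fin 2) (Fin 2) ℝ)‖ ^ 2}

/-- The periodic orbits of the geodesic flow contained in `Ω'_δ` with discriminant at most `D`. -/
def periodicOrbitsIn (δ D : ℝ) : Set (Set X) :=
  {Y | IsPeriodicOrbit Y ∧ Y ⊆ Omega δ ∧ (disc Y : ℝ) ≤ D}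

end PGL2Geodesic

end

noncomputable section

namespace PGL2Geodesic

/-! Closed geodesics are produced from periodic continued fractions with bounded digits. A nonempty
word with digits in {1, …, N} has an integral matrix M of determinant ±1 with fixed points α > 1 and
-1 < β < 0. If g has columns (α, 1) and (β, 1), then M g = g · diag(l₁, l₂), so M² closes up the
orbit of Γg. The product of the two coordinates of m g is invariant under the flow and equals the
quadratic form of M at m divided by -M 1 0. A Euclidean descent (`trace_le_matrixForm`) bounds this
form below by a multiple of the trace depending only on N, so the orbit lies in a fixed Ω'_δ
(`orbit_word`). Its discriminant is at most tr(M)² - 4 det(M), which is O(R²) when the entries of M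
are O(R).

Many such words exist because digits bounded by a large N lose little. The interval of continued
fractions with last denominators p, q has length 1/(p(p+q)); for s < 1 and N large, the s-th powers
of the lengths of its N children add up to at least that of the parent (`intervalWeight_le_sum`).
Subdividing until the denominator exceeds R leaves at least R^(2s) words with disjoint intervals
(`exists_separated_words`). For R of order √Δ this is of order Δ^s.

Several words may give the same orbit Y, but only O(length Y) of them (`exists_card_le_length`):
base points within unit time of each other are related by one of finitely many integral matrices,
which determines α and hence the word. Summing over Y, the number of words is at most a constant
times the total length.

Compactness rests on representatives with bounded entries (`exists_reduced`). Finiteness holds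
because, at such a representative g, half the coordinates of Ad(g) diag(1,-1) are bounded and have
rational squares of denominator at most Δ, and they determine the orbit. -/

/-! ### Continued fraction words -/

/-- The elementary continued fraction matrix with partial quotient `a`. -/
def digitMatrix (a : ℕ) : Matrix (Fin 2) (Fin 2) ℤ := !![(a : ℤ), 1; 1, 0]

/-- The product of the elementary matrices of a word of partial quotients. -/
def wordMatrix (w : List ℕ) : Matrix (Fin 2) (Fin 2) ℤ := (w.map digitMatrix).prod

/-- All letters of the word `w` lie between `1` and `N`. -/
def IsBoundedWord (N : ℕ) (w : List ℕ) : Prop := ∀ a ∈ w, 1 ≤ a ∧ a ≤ N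

/-- The binary quadratic form `m ↦ det (m, m M)` attached to a `2 × 2` matrix `M`. -/
def matrixForm (M : Matrix (Fin 2) (Fin 2) ℤ) (x y : ℤ) : ℤ :=
  M 0 1 * x ^ 2 + (M 1 1 - M 0 0) * x * y - M 1 0 * y ^ 2

theorem wordMatrix_nil : wordMatrix [] = 1 := rfl

theorem wordMatrix_cons (a : ℕ) (w : List ℕ) :
    wordMatrix (a :: w) = digitMatrix a * wordMatrix w := by
  simp [wordMatrix]

theorem wordMatrix_concat (w : List ℕ) (a : ℕ) :
    wordMatrix (w ++ [a]) = wordMatrix w * digitMatrix a := by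
  simp [wordMatrix]

theorem digitMatrix_transpose (a : ℕ) : (digitMatrix a)ᵀ = digitMatrix a := by
  ext i j
  fin_cases i <;> fin_cases j <;> simp [digitMatrix]

theorem wordMatrix_reverse (w : List ℕ) : wordMatrix w.reverse = (wordMatrix w)ᵀ := by
  induction w with
  | nil => simp [wordMatrix_nil]
  | cons a w ih =>
    rw [List.reverse_cons, wordMatrix_concat, ih, wordMatrix_cons, transpose_mul,
      digitMatrix_transpose]

theorem wordMatrix_det (w : List ℕ) : (wordMatrix w).det = 1 ∨ (wordMatrix w).det = -1 := by
  induction w with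
  | nil => simp [wordMatrix_nil]
  | cons a w ih =>
    rw [wordMatrix_cons, det_mul]
    rcases ih with h | h <;> simp [h, digitMatrix, det_fin_two]

theorem wordMatrix_cons_apply (a : ℕ) (w : List ℕ) :
    wordMatrix (a :: w) 0 0 = a * wordMatrix w 0 0 + wordMatrix w 1 0 ∧
    wordMatrix (a :: w) 0 1 = a * wordMatrix w 0 1 + wordMatrix w 1 1 ∧
    wordMatrix (a :: w) 1 0 = wordMatrix w 0 0 ∧
    wordMatrix (a :: w) 1 1 = wordMatrix w 0 1 := by
  rw [wordMatrix_cons]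
  simp [digitMatrix, mul_apply, Fin.sum_univ_two]

theorem wordMatrix_concat_apply (w : List ℕ) (a : ℕ) :
    wordMatrix (w ++ [a]) 0 0 = a * wordMatrix w 0 0 + wordMatrix w 0 1 ∧
    wordMatrix (w ++ [a]) 0 1 = wordMatrix w 0 0 ∧
    wordMatrix (w ++ [a]) 1 0 = a * wordMatrix w 1 0 + wordMatrix w 1 1 ∧
    wordMatrix (w ++ [a]) 1 1 = wordMatrix w 1 0 := by
  rw [wordMatrix_concat]
  simp [digitMatrix, mul_apply, Fin.sum_univ_two, mul_comm]

theorem IsBoundedWord.reverse {N : ℕ} {w : List ℕ} (h : IsBoundedWord N w) :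
    IsBoundedWord N w.reverse := fun a ha => h a (List.mem_reverse.1 ha)

/-- The conjunction is chosen to survive prepending a digit: the comparison of the two column sums
is what carries the comparison of the first-row entries to the longer word, and the positivity of
the second column sum makes the entry `0 1` positive after one digit. -/
theorem wordMatrix_entries {N : ℕ} {w : List ℕ} (h : IsBoundedWord N w) :
    1 ≤ wordMatrix w 0 0 ∧ 0 ≤ wordMatrix w 0 1 ∧ 0 ≤ wordMatrix w 1 0 ∧ 0 ≤ wordMatrix w 1 1 ∧
    wordMatrix w 0 1 ≤ wordMatrix w 0 0 ∧ wordMatrix w 1 0 ≤ wordMatrix w 0 0 ∧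
    wordMatrix w 0 1 + wordMatrix w 1 1 ≤ wordMatrix w 0 0 + wordMatrix w 1 0 ∧
    1 ≤ wordMatrix w 0 1 + wordMatrix w 1 1 := by
  induction w with
  | nil => simp [wordMatrix_nil]
  | cons a w ih =>
    obtain ⟨h1, h2, h3, h4, h5, h6, h7, h8⟩ := ih fun b hb => h b (List.mem_cons_of_mem _ hb)
    obtain ⟨e1, e2, e3, e4⟩ := wordMatrix_cons_apply a w
    have ha : (1 : ℤ) ≤ a := by exact_mod_cast (h a List.mem_cons_self).1
    rw [e1, e2, e3, e4]
    refine ⟨?_, ?_, ?_, ?_, ?_, ?_, ?_, ?_⟩ <;> nlinarith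

/-- The last bound says that one digit, being at most N, enlarges the leading entry by a factor at
most N + 1. -/
theorem wordMatrix_entries_of_ne_nil {N : ℕ} {w : List ℕ} (h : IsBoundedWord N w) (hw : w ≠ []) :
    1 ≤ wordMatrix w 0 1 ∧ 1 ≤ wordMatrix w 1 0 ∧
    wordMatrix w 1 1 ≤ wordMatrix w 0 1 ∧ wordMatrix w 1 1 ≤ wordMatrix w 1 0 ∧
    wordMatrix w 0 0 ≤ (N + 1) * wordMatrix w 1 0 := by
  cases w with
  | nil => exact absurd rfl hw
  | cons a w =>
    obtain ⟨h1, h2, h3, h4, h5, h6, h7, h8⟩ :=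
      wordMatrix_entries fun b hb => h b (List.mem_cons_of_mem a hb)
    obtain ⟨e1, e2, e3, e4⟩ := wordMatrix_cons_apply a w
    have ha : (1 : ℤ) ≤ a := by exact_mod_cast (h a List.mem_cons_self).1
    have ha' : (a : ℤ) ≤ N := by exact_mod_cast (h a List.mem_cons_self).2
    rw [e1, e2, e3, e4]
    refine ⟨?_, ?_, ?_, ?_, ?_⟩ <;> nlinarith

theorem wordMatrix_zero_zero_le {N : ℕ} {w : List ℕ} (h : IsBoundedWord N w) (hw : w ≠ []) :
    wordMatrix w 0 0 ≤ (N + 1) * wordMatrix w 0 1 := by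
  have := (wordMatrix_entries_of_ne_nil h.reverse (by simpa using hw)).2.2.2.2
  simpa [wordMatrix_reverse] using this

theorem wordMatrix_trace_pos {N : ℕ} {w : List ℕ} (h : IsBoundedWord N w) :
    1 ≤ (wordMatrix w).trace := by
  have := wordMatrix_entries h
  rw [trace_fin_two]
  lia

theorem wordMatrix_trace_le {N : ℕ} {w : List ℕ} (h : IsBoundedWord N w) (hw : w ≠ []) :
    (wordMatrix w).trace ≤ 2 * wordMatrix w 0 0 := by
  have := wordMatrix_entries h
  have := wordMatrix_entries_of_ne_nil h hw
  rw [trace_fin_two]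
  lia

/-- The form of a word of bounded partial quotients is bounded below on the positive quadrant. -/
theorem trace_le_matrixForm_of_pos {N : ℕ} (n : ℕ) :
    ∀ {w : List ℕ}, IsBoundedWord N w → w ≠ [] → ∀ {x y : ℤ}, 0 < x → 0 < y → x + y ≤ n →
      (wordMatrix w).trace ≤ 2 * (N + 1) ^ 2 * |matrixForm (wordMatrix w) x y| := by
  induction n with
  | zero => intro w _ _ x y hx hy h; push_cast at h; lia
  | succ n ih =>
    intro w hw hne x y hx hy hxy
    obtain ⟨v, a, rfl⟩ : ∃ v a, w = v ++ [a] := ⟨_, _, (List.dropLast_append_getLast hne).symm⟩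
    have hv : IsBoundedWord N v := fun b hb => hw b (List.mem_append_left _ hb)
    have ha : (1 : ℤ) ≤ a := by exact_mod_cast (hw a (by simp)).1
    obtain ⟨e1, e2, e3, e4⟩ := wordMatrix_concat_apply v a
    obtain ⟨h1, h2, h3, h4, h5, h6, h7, h8⟩ := wordMatrix_entries hv
    have ht := wordMatrix_trace_le hw hne
    have hp := wordMatrix_zero_zero_le hw hne
    rcases lt_or_ge (a * y - x) 0 with hz | hz
    -- Moving the last digit to the front conjugates the matrix by `digitMatrix a`, of determinant
    -- -1. The trace is kept, the form changes sign, and (x, y) becomes (y, x - a y), a Euclidean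
    -- step with smaller sum.
    · have hav : IsBoundedWord N (a :: v) := fun b hb => hw b (by
        rcases List.mem_cons.1 hb with rfl | hb <;> simp [*])
      have := ih hav (by simp) (x := y) (y := x - a * y) hy (by lia)
        (by push_cast at hxy; nlinarith)
      obtain ⟨c1, c2, c3, c4⟩ := wordMatrix_cons_apply a v
      have hf : matrixForm (wordMatrix (a :: v)) y (x - a * y) =
          - matrixForm (wordMatrix (v ++ [a])) x y := by
        rw [matrixForm, matrixForm, c1, c2, c3, c4, e1, e2, e3, e4]
        ring
      rw [hf, abs_neg] at this
      convert this using 1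
      rw [trace_fin_two, trace_fin_two, c1, c4, e1, e4]
      ring
    -- Now x ≤ a y, and the negated form is a sum of four nonnegative terms. If x < a y the third
    -- already dominates `wordMatrix v 0 0`; if x = a y only the second and fourth survive, and they
    -- dominate it up to the factor N + 1.
    · have hf : - matrixForm (wordMatrix (v ++ [a])) x y =
          wordMatrix v 1 0 * y * (a * y - x) + wordMatrix v 1 1 * y ^ 2 +
            wordMatrix v 0 0 * x * (a * y - x) + wordMatrix v 0 1 * x * y := by
        rw [matrixForm, e1, e2, e3, e4]
        ring
      rw [e2] at hp
      have key : wordMatrix v 0 0 ≤ (N + 1) * - matrixForm (wordMatrix (v ++ [a])) x y := by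
        have t1 : 0 ≤ wordMatrix v 1 0 * y * (a * y - x) := by positivity
        have t2 : wordMatrix v 1 1 ≤ wordMatrix v 1 1 * y ^ 2 :=
          le_mul_of_one_le_right h4 (by nlinarith)
        have t4 : wordMatrix v 0 1 ≤ wordMatrix v 0 1 * x * y := by
          rw [mul_assoc]; exact le_mul_of_one_le_right h2 (by nlinarith)
        rcases hz.eq_or_lt with hz0 | hz0
        · have t3 : wordMatrix v 0 0 ≤ (N + 1) * (wordMatrix v 0 1 + wordMatrix v 1 1) := by
            rcases eq_or_ne v [] with rfl | hv0
            · simp [wordMatrix_nil]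
            · nlinarith [wordMatrix_zero_zero_le hv hv0]
          rw [← hz0] at hf
          refine t3.trans (mul_le_mul_of_nonneg_left ?_ (by positivity))
          rw [hf]; linarith
        · have t5 : wordMatrix v 0 0 ≤ wordMatrix v 0 0 * x * (a * y - x) := by
            rw [mul_assoc]
            exact le_mul_of_one_le_right (by linarith)
              (by have := mul_le_mul (show (1 : ℤ) ≤ x by lia) (show 1 ≤ a * y - x by lia)
                    zero_le_one hx.le
                  linarith)
          have : wordMatrix v 0 0 ≤ - matrixForm (wordMatrix (v ++ [a])) x y := by
            rw [hf]; linarith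
          nlinarith
      have hN : (0 : ℤ) ≤ N + 1 := by positivity
      calc (wordMatrix (v ++ [a])).trace ≤ 2 * wordMatrix (v ++ [a]) 0 0 := ht
        _ ≤ 2 * ((N + 1) * wordMatrix v 0 0) := by linarith
        _ ≤ 2 * ((N + 1) * ((N + 1) * - matrixForm (wordMatrix (v ++ [a])) x y)) := by gcongr
        _ ≤ 2 * ((N + 1) * ((N + 1) * |matrixForm (wordMatrix (v ++ [a])) x y|)) := by
          gcongr; exact neg_le_abs _
        _ = _ := by ring

theorem matrixForm_transpose (M : Matrix (Fin 2) (Fin 2) ℤ) (x y : ℤ) :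
    matrixForm Mᵀ x y = - matrixForm M (-y) x := by
  simp only [matrixForm, transpose_apply]
  ring

theorem matrixForm_neg (M : Matrix (Fin 2) (Fin 2) ℤ) (x y : ℤ) :
    matrixForm M (-x) (-y) = matrixForm M x y := by
  simp only [matrixForm]
  ring

/-- The form of a word of bounded partial quotients is bounded below away from the origin. -/
theorem trace_le_matrixForm {N : ℕ} {w : List ℕ} (hw : IsBoundedWord N w) (hne : w ≠ [])
    {x y : ℤ} (h : x ≠ 0 ∨ y ≠ 0) :
    (wordMatrix w).trace ≤ 2 * (N + 1) ^ 2 * |matrixForm (wordMatrix w) x y| := by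
  have pos : ∀ {v : List ℕ}, IsBoundedWord N v → v ≠ [] → ∀ {x y : ℤ}, 0 < x → 0 < y →
      (wordMatrix v).trace ≤ 2 * (N + 1) ^ 2 * |matrixForm (wordMatrix v) x y| :=
    fun {v} hv hv' {x y} hx hy =>
      trace_le_matrixForm_of_pos (x + y).toNat hv hv' hx hy (by lia)
  -- Reversing the word transposes its matrix, which turns the form by a quarter turn and so
  -- exchanges the quadrants.
  have neg : ∀ {x y : ℤ}, x < 0 → 0 < y →
      (wordMatrix w).trace ≤ 2 * (N + 1) ^ 2 * |matrixForm (wordMatrix w) x y| := by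
    intro x y hx hy
    have := pos hw.reverse (by simpa using hne) (x := y) (y := -x) hy (by lia)
    rwa [wordMatrix_reverse, matrixForm_transpose, trace_transpose, abs_neg, neg_neg] at this
  have ht := wordMatrix_trace_le hw hne
  have hq := wordMatrix_zero_zero_le hw hne
  obtain ⟨g1, g2, -, -, hr⟩ := wordMatrix_entries_of_ne_nil hw hne
  have hN : (0 : ℤ) ≤ N := by positivity
  have axis : ∀ {c z : ℤ}, 1 ≤ c → wordMatrix w 0 0 ≤ (N + 1) * c → z ≠ 0 →
      (wordMatrix w).trace ≤ 2 * (N + 1) ^ 2 * (c * z ^ 2) := by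
    intro c z hc hpc hz
    have hz2 : 1 ≤ z ^ 2 := by have := sq_pos_of_ne_zero hz; lia
    calc (wordMatrix w).trace ≤ 2 * (N + 1) * c * 1 := by linarith
      _ ≤ 2 * (N + 1) * c * ((N + 1) * z ^ 2) :=
          mul_le_mul_of_nonneg_left (by nlinarith) (by positivity)
      _ = _ := by ring
  rcases lt_trichotomy x 0 with hx | rfl | hx <;> rcases lt_trichotomy y 0 with hy | rfl | hy
  · rw [← matrixForm_neg]; exact pos hw hne (by lia) (by lia)
  · have : |matrixForm (wordMatrix w) x 0| = wordMatrix w 0 1 * x ^ 2 := by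
      rw [matrixForm, abs_of_nonneg] <;> simp; positivity
    rw [this]; exact axis g1 hq hx.ne
  · exact neg hx hy
  · have : |matrixForm (wordMatrix w) 0 y| = wordMatrix w 1 0 * y ^ 2 := by
      rw [matrixForm, abs_of_nonpos] <;> simp; positivity
    rw [this]; exact axis g2 hr hy.ne
  · simp at h
  · have : |matrixForm (wordMatrix w) 0 y| = wordMatrix w 1 0 * y ^ 2 := by
      rw [matrixForm, abs_of_nonpos] <;> simp; positivity
    rw [this]; exact axis g2 hr hy.ne'
  · rw [← matrixForm_neg]; exact neg (by lia) (by lia)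
  · have : |matrixForm (wordMatrix w) x 0| = wordMatrix w 0 1 * x ^ 2 := by
      rw [matrixForm, abs_of_nonneg] <;> simp; positivity
    rw [this]; exact axis g1 hq hx.ne'
  · exact pos hw hne hx hy

/-! ### Separated families of words -/

/-- The Möbius action of the matrix of a word. -/
def wordMobius (w : List ℕ) (x : ℝ) : ℝ := w.foldr (fun a y => a + 1 / y) x

theorem wordMobius_cons (a : ℕ) (w : List ℕ) (x : ℝ) :
    wordMobius (a :: w) x = a + 1 / wordMobius w x := rfl

theorem one_lt_wordMobius {N : ℕ} {w : List ℕ} (hw : IsBoundedWord N w) {x : ℝ} (hx : 1 < x) :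
    1 < wordMobius w x := by
  induction w with
  | nil => exact hx
  | cons a w ih =>
    have h := ih fun b hb => hw b (List.mem_cons_of_mem _ hb)
    have ha : (1 : ℝ) ≤ a := by exact_mod_cast (hw a List.mem_cons_self).1
    have : 0 < 1 / wordMobius w x := by positivity
    rw [wordMobius_cons]
    linarith

theorem wordMobius_lt {N : ℕ} {w : List ℕ} (hw : IsBoundedWord N w) (hne : w ≠ [])
    {x : ℝ} (hx : 1 < x) : wordMobius w x < N + 1 := by
  cases w with
  | nil => exact absurd rfl hne
  | cons a w =>
    have h := one_lt_wordMobius (fun b hb => hw b (List.mem_cons_of_mem a hb)) hx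
    have ha : (a : ℝ) ≤ N := by exact_mod_cast (hw a List.mem_cons_self).2
    have : 1 / wordMobius w x < 1 := by rw [div_lt_one] <;> linarith
    rw [wordMobius_cons]
    linarith

theorem wordMobius_spec {N : ℕ} {w : List ℕ} (hw : IsBoundedWord N w) {x : ℝ} (hx : 1 < x) :
    wordMatrix w 0 0 * x + wordMatrix w 0 1 =
      wordMobius w x * (wordMatrix w 1 0 * x + wordMatrix w 1 1) := by
  induction w with
  | nil => simp [wordMatrix_nil, wordMobius]
  | cons a w ih =>
    have hw' : IsBoundedWord N w := fun b hb => hw b (List.mem_cons_of_mem _ hb)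
    have h := ih hw'
    have h1 := one_lt_wordMobius hw' hx
    obtain ⟨c1, c2, c3, c4⟩ := wordMatrix_cons_apply a w
    rw [c1, c2, c3, c4, wordMobius_cons]
    push_cast
    field_simp
    linear_combination -h

/-- The words of `S` are distinguished by the initial segments of continued fractions. -/
def IsSeparated (S : Finset (List ℕ)) : Prop :=
  ∀ v ∈ S, ∀ w ∈ S, ∀ x y : ℝ, 1 < x → 1 < y → wordMobius v x = wordMobius w y → v = w

theorem digit_eq_of_add_inv_eq {a b : ℕ} {x y : ℝ} (hx : 1 < x) (hy : 1 < y)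
    (h : a + 1 / x = b + 1 / y) : a = b ∧ x = y := by
  have hx0 : 0 < 1 / x := by positivity
  have hy0 : 0 < 1 / y := by positivity
  have hx1 : 1 / x < 1 := by rw [div_lt_one] <;> linarith
  have hy1 : 1 / y < 1 := by rw [div_lt_one] <;> linarith
  have hab : a = b := by
    have h1 : (a : ℝ) < b + 1 := by linarith
    have h2 : (b : ℝ) < a + 1 := by linarith
    have h1' : a < b + 1 := by exact_mod_cast h1
    have h2' : b < a + 1 := by exact_mod_cast h2
    lia
  subst hab
  refine ⟨rfl, ?_⟩
  have : 1 / x = 1 / y := by linarith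
  simpa using this

/-- The weight of a continued fraction interval as a function of its last two denominators. -/
def intervalWeight (s p q : ℝ) : ℝ := (p * (p + q)) ^ (-s)

/-- Let t be the ratio of the length of the a-th child interval to that of its parent. These ratios
telescope to a sum of at least 1 - 2/(N+1), and each is at most 1/2, so t^s ≥ 2^(1-s) t. The
hypothesis on N then makes the sum of the t^s at least 1. -/
theorem intervalWeight_le_sum {s : ℝ} (hs1 : s < 1) {N : ℕ}
    (hN : 1 ≤ (2 : ℝ) ^ (1 - s) * (1 - 2 / (N + 1))) {p q : ℝ} (hp : 0 < p) (hq : 0 ≤ q)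
    (hqp : q ≤ p) :
    intervalWeight s p q ≤ ∑ a ∈ Finset.Icc 1 N, intervalWeight s (a * p + q) p := by
  have tel : ∑ a ∈ Finset.Icc 1 N,
      p * (p + q) / ((a * p + q) * (a * p + q + p)) = 1 - (p + q) / ((N + 1) * p + q) := by
    clear hN
    induction N with
    | zero => simp; field_simp; simp
    | succ n ih =>
      rw [Finset.sum_Icc_succ_top (by lia), ih]
      push_cast
      have h1 : ((n : ℝ) + 1) * p + q ≠ 0 := by positivity
      have h2 : ((n : ℝ) + 1) * p + q + p ≠ 0 := by positivity
      have h3 : ((n : ℝ) + 1 + 1) * p + q ≠ 0 := by positivity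
      field_simp
      ring
  have htail : (p + q) / ((N + 1) * p + q) ≤ 2 / (N + 1) := by
    rw [div_le_div_iff₀ (by positivity) (by positivity)]
    nlinarith [mul_nonneg (show (0:ℝ) ≤ N + 1 by positivity) (sub_nonneg.2 hqp)]
  have h2 : (0 : ℝ) < 2 ^ (1 - s) := by positivity
  have hF : 0 < p * (p + q) := by positivity
  have hterm : ∀ a ∈ Finset.Icc 1 N,
      (2 : ℝ) ^ (1 - s) * (p * (p + q) / ((a * p + q) * (a * p + q + p))) * (p * (p + q)) ^ (-s) ≤
        intervalWeight s (a * p + q) p := by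
    intro a ha
    have ha1 : (1 : ℝ) ≤ a := by exact_mod_cast (Finset.mem_Icc.1 ha).1
    have hap : p ≤ a * p := le_mul_of_one_le_left hp.le ha1
    set G := (a * p + q) * (a * p + q + p) with hG
    have hGpos : 0 < G := by positivity
    have hx : p * (p + q) / G ≤ 1 / 2 := by
      rw [div_le_div_iff₀ hGpos two_pos, hG]
      nlinarith [mul_nonneg hp.le hq, mul_nonneg (sub_nonneg.2 hap) hp.le,
        mul_nonneg (sub_nonneg.2 hap) hq, mul_nonneg (sub_nonneg.2 hap) (sub_nonneg.2 hap)]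
    have hx0 : 0 < p * (p + q) / G := by positivity
    set t := p * (p + q) / G with ht
    have e : G = p * (p + q) / t := by rw [ht]; field_simp
    rw [intervalWeight, ← hG, e, Real.div_rpow hF.le hx0.le, Real.rpow_neg hx0.le s, div_inv_eq_mul,
      mul_comm]
    refine mul_le_mul_of_nonneg_left ?_ (by positivity)
    calc (2 : ℝ) ^ (1 - s) * t = 2 ^ (1 - s) * (t ^ (1 - s) * t ^ s) := by
          rw [← Real.rpow_add hx0]; simp
      _ = (2 * t) ^ (1 - s) * t ^ s := by
          rw [Real.mul_rpow two_pos.le hx0.le]; ring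
      _ ≤ 1 * t ^ s := by
          gcongr
          exact Real.rpow_le_one (by positivity) (by linarith) (by linarith)
      _ = t ^ s := one_mul _
  refine le_trans ?_ (Finset.sum_le_sum hterm)
  rw [← Finset.sum_mul, ← Finset.mul_sum, tel, intervalWeight]
  refine le_mul_of_one_le_left (by positivity) (hN.trans ?_)
  gcongr

/-- Leaf of the subdivision: once p > R, the weight is at most R^(-2s), so the empty word alone
suffices. -/
theorem exists_separated_words_of_lt {s : ℝ} (hs0 : 0 < s) {N : ℕ} {R : ℝ} (hR : 0 < R)
    {p q : ℕ} (hRp : R < p) (hpR : (p : ℝ) ≤ (N + 1) * R) :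
    ∃ S : Finset (List ℕ), (∀ w ∈ S, IsBoundedWord N w) ∧
      (∀ w ∈ S, R < p * wordMatrix w 0 0 + q * wordMatrix w 1 0 ∧
        p * wordMatrix w 0 0 + q * wordMatrix w 1 0 ≤ (N + 1) * R) ∧
      IsSeparated S ∧ intervalWeight s p q ≤ S.card * R ^ (-(2 * s)) := by
  refine ⟨{[]}, ?_, ?_, ?_, ?_⟩
  · simp [IsBoundedWord]
  · simp only [Finset.mem_singleton, forall_eq, wordMatrix_nil, one_apply_eq, ne_eq,
      one_ne_zero, not_false_eq_true, one_apply_ne, Int.cast_one, Int.cast_zero]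
    constructor <;> linarith
  · intro v hv w hw _ _ _ _ _
    rw [Finset.mem_singleton.1 hv, Finset.mem_singleton.1 hw]
  · simp only [Finset.card_singleton, Nat.cast_one, one_mul, intervalWeight]
    rw [← mul_neg, Real.rpow_mul hR.le, Real.rpow_two]
    refine Real.rpow_le_rpow_of_nonpos (by positivity) ?_ (by linarith)
    nlinarith [mul_nonneg (Nat.cast_nonneg (α := ℝ) p) (Nat.cast_nonneg (α := ℝ) q)]

/-- The row (p, q) records the digits already chosen; a digit a replaces it by (a p + q, p).
Subdivision continues while p ≤ R, so a denominator never exceeds (N + 1) R, and the weight of a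
node is at most the sum over its children. The counter k bounds the depth: p + q grows by at least 1
at each step, and p + q > 2R with q ≤ p forces p > R. -/
theorem exists_separated_words_of_state {s : ℝ} (hs0 : 0 < s) (hs1 : s < 1) {N : ℕ}
    (hN : 1 ≤ (2 : ℝ) ^ (1 - s) * (1 - 2 / (N + 1))) {R : ℝ} (hR : 0 < R) (k : ℕ) :
    ∀ p q : ℕ, 0 < p → q ≤ p → 2 * R < p + q + k → (p : ℝ) ≤ (N + 1) * R →
      ∃ S : Finset (List ℕ), (∀ w ∈ S, IsBoundedWord N w) ∧
        (∀ w ∈ S, R < p * wordMatrix w 0 0 + q * wordMatrix w 1 0 ∧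
          p * wordMatrix w 0 0 + q * wordMatrix w 1 0 ≤ (N + 1) * R) ∧
        IsSeparated S ∧ intervalWeight s p q ≤ S.card * R ^ (-(2 * s)) := by
  induction k with
  | zero =>
    intro p q hp hqp hk hpR
    have hqp' : (q : ℝ) ≤ p := by exact_mod_cast hqp
    push_cast at hk
    exact exists_separated_words_of_lt hs0 hR (by linarith) hpR
  | succ k ih =>
    intro p q hp hqp hk hpR
    have hqp' : (q : ℝ) ≤ p := by exact_mod_cast hqp
    rcases lt_or_ge R p with hRp | hRp
    · exact exists_separated_words_of_lt hs0 hR hRp hpR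
    · have hp1 : (1 : ℝ) ≤ p := by exact_mod_cast hp
      have step : ∀ a : ℕ, ∃ S : Finset (List ℕ), a ∈ Finset.Icc 1 N →
          (∀ w ∈ S, IsBoundedWord N w) ∧
          (∀ w ∈ S, R < (a * p + q) * wordMatrix w 0 0 + p * wordMatrix w 1 0 ∧
            (a * p + q) * wordMatrix w 0 0 + p * wordMatrix w 1 0 ≤ (N + 1) * R) ∧
          IsSeparated S ∧ intervalWeight s (a * p + q) p ≤ S.card * R ^ (-(2 * s)) := by
        intro a
        by_cases ha : a ∈ Finset.Icc 1 N
        · obtain ⟨ha1, haN⟩ := Finset.mem_Icc.1 ha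
          have ha1' : (1 : ℝ) ≤ a := by exact_mod_cast ha1
          have haN' : (a : ℝ) ≤ N := by exact_mod_cast haN
          obtain ⟨S, hS⟩ := ih (a * p + q) p (by positivity) (by nlinarith)
            (by push_cast at hk ⊢; nlinarith) (by push_cast; nlinarith)
          exact ⟨S, fun _ => by simpa using hS⟩
        · exact ⟨∅, fun h => absurd h ha⟩
      choose T hT using step
      refine ⟨(Finset.Icc 1 N).biUnion fun a => (T a).image (List.cons a), ?_, ?_, ?_, ?_⟩
      · intro w hw
        simp only [Finset.mem_biUnion, Finset.mem_image] at hw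
        obtain ⟨a, ha, v, hv, rfl⟩ := hw
        intro b hb
        rcases List.mem_cons.1 hb with rfl | hb
        · exact Finset.mem_Icc.1 ha
        · exact (hT a ha).1 v hv b hb
      · intro w hw
        simp only [Finset.mem_biUnion, Finset.mem_image] at hw
        obtain ⟨a, ha, v, hv, rfl⟩ := hw
        have := (hT a ha).2.1 v hv
        obtain ⟨c1, c2, c3, c4⟩ := wordMatrix_cons_apply a v
        have e : (p : ℝ) * (wordMatrix (a :: v) 0 0 : ℤ) + q * (wordMatrix (a :: v) 1 0 : ℤ) =
            (a * p + q) * wordMatrix v 0 0 + p * wordMatrix v 1 0 := by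
          rw [c1, c3]; push_cast; ring
        rw [e]
        exact this
      · intro v hv w hw x y hx hy hvw
        simp only [Finset.mem_biUnion, Finset.mem_image] at hv hw
        obtain ⟨a, ha, v, hv, rfl⟩ := hv
        obtain ⟨b, hb, w, hw, rfl⟩ := hw
        rw [wordMobius_cons, wordMobius_cons] at hvw
        obtain ⟨rfl, h⟩ := digit_eq_of_add_inv_eq (one_lt_wordMobius ((hT a ha).1 v hv) hx)
          (one_lt_wordMobius ((hT b hb).1 w hw) hy) hvw
        rw [(hT a ha).2.2.1 v hv w hw x y hx hy h]
      · rw [Finset.card_biUnion]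
        · push_cast
          rw [Finset.sum_mul]
          refine (intervalWeight_le_sum hs1 hN (by positivity) (by positivity) hqp').trans
            (Finset.sum_le_sum fun a ha => ?_)
          rw [Finset.card_image_of_injective _ List.cons_injective]
          exact (hT a ha).2.2.2
        · intro a _ b _ hab
          refine Finset.disjoint_left.2 ?_
          intro w hw hw'
          simp only [Finset.mem_image] at hw hw'
          obtain ⟨v, _, rfl⟩ := hw
          obtain ⟨v', _, h⟩ := hw'
          exact hab (List.cons_eq_cons.1 h).1.symm

/-- Many separated words of bounded partial quotients with matrices of norm about `R`. -/
theorem exists_separated_words {s : ℝ} (hs0 : 0 < s) (hs1 : s < 1) {N : ℕ}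
    (hN : 1 ≤ (2 : ℝ) ^ (1 - s) * (1 - 2 / (N + 1))) {R : ℝ} (hR : 1 ≤ R) :
    ∃ S : Finset (List ℕ), (∀ w ∈ S, IsBoundedWord N w ∧ w ≠ []) ∧
      (∀ w ∈ S, (wordMatrix w 0 0 : ℝ) ≤ (N + 1) * R) ∧
      IsSeparated S ∧ R ^ (2 * s) ≤ S.card := by
  obtain ⟨k, hk⟩ := exists_nat_gt (2 * R)
  have hN0 : (0 : ℝ) ≤ N := by positivity
  -- The initial row (1, 0) has weight 1, and the final denominator is then the entry `0 0`. The
  -- empty word is excluded because it would give R < 1.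
  obtain ⟨S, h1, h2, h3, h4⟩ := exists_separated_words_of_state hs0 hs1 hN
    (zero_lt_one.trans_le hR) k 1 0 one_pos zero_le_one (by simp; linarith) (by push_cast; nlinarith)
  have hR0 : 0 < R := by linarith
  refine ⟨S, fun w hw => ⟨h1 w hw, ?_⟩, fun w hw => by simpa using (h2 w hw).2, h3, ?_⟩
  · rintro rfl
    have := (h2 _ hw).1
    simp [wordMatrix_nil] at this
    linarith
  · simp only [intervalWeight, Nat.cast_one, Nat.cast_zero, add_zero, mul_one, Real.one_rpow] at h4
    rwa [Real.rpow_neg hR0.le, ← div_eq_mul_inv, le_div_iff₀ (by positivity), one_mul] at h4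

/-! ### Cosets, the flow and its orbits -/

/-- The real matrix with the same entries as an integral one. -/
abbrev toReal (M : Matrix (Fin 2) (Fin 2) ℤ) : Matrix (Fin 2) (Fin 2) ℝ :=
  M.map (Int.cast : ℤ → ℝ)

theorem toReal_mul (M M' : Matrix (Fin 2) (Fin 2) ℤ) :
    toReal (M * M') = toReal M * toReal M' :=
  Matrix.map_mul (f := Int.castRingHom ℝ)

theorem toReal_det (M : Matrix (Fin 2) (Fin 2) ℤ) : (toReal M).det = M.det := by
  simp [det_fin_two]

/-- Turns equality in X into a matrix identity; the scalar c accounts for the centre. -/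
theorem coset_eq_iff {g g' : GL (Fin 2) ℝ} :
    coset (ProjGenLinGroup.mk g) = coset (ProjGenLinGroup.mk g') ↔
      ∃ (γ : GL (Fin 2) ℤ) (c : ℝ), c ≠ 0 ∧
        (g' : Matrix (Fin 2) (Fin 2) ℝ) = c • (toReal γ * (g : Matrix (Fin 2) (Fin 2) ℝ)) := by
  have h1 : coset (ProjGenLinGroup.mk g) = coset (ProjGenLinGroup.mk g') ↔
      ProjGenLinGroup.mk g' * (ProjGenLinGroup.mk g)⁻¹ ∈ Gam := by
    rw [coset, coset, Quotient.eq, QuotientGroup.rightRel_apply]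
  rw [h1, Gam, MonoidHom.mem_range]
  constructor
  · rintro ⟨x, hx⟩
    induction x using ProjGenLinGroup.induction_on with
    | mk γ =>
    rw [ProjGenLinGroup.map_mk, eq_mul_inv_iff_mul_eq, ← map_mul, ProjGenLinGroup.mk_eq_mk_iff] at hx
    obtain ⟨u, hu⟩ := hx
    refine ⟨γ, u, u.ne_zero, ?_⟩
    rw [← hu]
    ext i j
    simp [mul_comm]
  · rintro ⟨γ, c, hc, h⟩
    refine ⟨ProjGenLinGroup.mk γ, ?_⟩
    rw [ProjGenLinGroup.map_mk, eq_mul_inv_iff_mul_eq, ← map_mul, ProjGenLinGroup.mk_eq_mk_iff]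
    refine ⟨Units.mk0 c hc, Units.ext ?_⟩
    rw [h]
    ext i j
    simp [mul_comm]

theorem exists_coset_mk (x : X) : ∃ g : GL (Fin 2) ℝ, x = coset (ProjGenLinGroup.mk g) := by
  induction x using Quotient.inductionOn with
  | h y =>
    obtain ⟨g, rfl⟩ := ProjGenLinGroup.mk_surjective y
    exact ⟨g, rfl⟩

theorem flow_coset (t : ℝ) (g : GL (Fin 2) ℝ) :
    flow t (coset (ProjGenLinGroup.mk g)) = coset (ProjGenLinGroup.mk (g * geodesicMatrix t)) := by
  rw [map_mul]; rfl

theorem coe_geodesicMatrix (t : ℝ) : (geodesicMatrix t : Matrix (Fin 2) (Fin 2) ℝ) =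
    !![Real.exp (t / 2), 0; 0, Real.exp (-t / 2)] := rfl

theorem geodesicMatrix_add (s t : ℝ) :
    geodesicMatrix (s + t) = geodesicMatrix s * geodesicMatrix t := by
  refine Units.ext ?_
  rw [Units.val_mul, coe_geodesicMatrix, coe_geodesicMatrix, coe_geodesicMatrix]
  ext i j
  fin_cases i <;> fin_cases j <;> simp [mul_apply, Fin.sum_univ_two, ← Real.exp_add] <;> ring

theorem flow_add (s t : ℝ) (x : X) : flow (s + t) x = flow t (flow s x) := by
  obtain ⟨g, rfl⟩ := exists_coset_mk x
  rw [flow_coset, flow_coset, flow_coset, geodesicMatrix_add, mul_assoc]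

theorem flow_zero (x : X) : flow 0 x = x := by
  obtain ⟨g, rfl⟩ := exists_coset_mk x
  have : geodesicMatrix 0 = 1 := by
    refine Units.ext ?_
    rw [coe_geodesicMatrix]
    ext i j
    fin_cases i <;> fin_cases j <;> simp
  rw [flow_coset, this, mul_one]

theorem mem_orbit_self (x : X) : x ∈ orbit x := ⟨0, flow_zero x⟩

theorem orbit_eq_of_mem {x y : X} (h : y ∈ orbit x) : orbit y = orbit x := by
  obtain ⟨s, rfl⟩ := h
  ext z
  constructor
  · rintro ⟨t, rfl⟩
    exact ⟨s + t, flow_add s t x⟩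
  · rintro ⟨t, rfl⟩
    refine ⟨t - s, ?_⟩
    simp only
    rw [← flow_add, add_sub_cancel]

theorem flow_eq_of_mem_orbit {x y : X} {T : ℝ} (hT : flow T x = x) (hy : y ∈ orbit x) :
    flow T y = y := by
  obtain ⟨s, rfl⟩ := hy
  simp only
  rw [← flow_add, add_comm, flow_add, hT]

theorem IsPeriodicOrbit.eq_orbit {Y : Set X} (hY : IsPeriodicOrbit Y) {y : X} (hy : y ∈ Y) :
    Y = orbit y := by
  obtain ⟨x, rfl, -⟩ := hY
  exact (orbit_eq_of_mem hy).symm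

theorem IsPeriodicOrbit.nonempty {Y : Set X} (hY : IsPeriodicOrbit Y) : Y.Nonempty := by
  obtain ⟨x, rfl, -⟩ := hY
  exact ⟨x, mem_orbit_self x⟩

theorem IsPeriodicOrbit.exists_period {Y : Set X} (hY : IsPeriodicOrbit Y) :
    ∃ T : ℝ, 0 < T ∧ ∀ y ∈ Y, flow T y = y := by
  obtain ⟨x, rfl, T, hT, h⟩ := hY
  exact ⟨T, hT, fun y hy => flow_eq_of_mem_orbit h hy⟩

theorem flow_nsmul {T : ℝ} {x : X} (h : flow T x = x) (n : ℕ) : flow (n * T) x = x := by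
  induction n with
  | zero => simpa using flow_zero x
  | succ n ih => push_cast; rw [add_mul, one_mul, flow_add, ih, h]

theorem flow_zsmul {T : ℝ} {x : X} (h : flow T x = x) (n : ℤ) : flow (n * T) x = x := by
  rcases n.eq_nat_or_neg with ⟨k, rfl | rfl⟩
  · exact_mod_cast flow_nsmul h k
  · have := flow_nsmul h k
    conv_lhs => rw [← this]
    rw [← flow_add]
    push_cast
    rw [neg_mul, add_neg_cancel, flow_zero]

/-- Times along a periodic orbit may be taken in a fundamental interval of any period. -/
theorem exists_mem_Ico_flow_eq {T : ℝ} (hT : 0 < T) {x y : X} (h : flow T x = x)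
    (hy : y ∈ orbit x) : ∃ s ∈ Set.Ico 0 T, flow s x = y := by
  obtain ⟨t, rfl⟩ := hy
  refine ⟨t - ⌊t / T⌋ * T, ⟨?_, ?_⟩, ?_⟩
  · have := Int.floor_le (t / T)
    rw [le_div_iff₀ hT] at this
    linarith
  · have := Int.lt_floor_add_one (t / T)
    rw [div_lt_iff₀ hT] at this
    linarith
  · have := flow_zsmul h (-⌊t / T⌋)
    push_cast at this
    simp only
    rw [sub_eq_add_neg, add_comm, flow_add, ← neg_mul, this]

/-- The integral matrix attached to a period of the geodesic flow. -/
theorem exists_integral_of_flow_eq {g : GL (Fin 2) ℝ} {T : ℝ}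
    (h : flow T (coset (ProjGenLinGroup.mk g)) = coset (ProjGenLinGroup.mk g)) :
    ∃ (γ : GL (Fin 2) ℤ) (c : ℝ), c ^ 2 = 1 ∧
      toReal γ = c • ((g : Matrix (Fin 2) (Fin 2) ℝ) * (geodesicMatrix T : Matrix _ _ ℝ) *
        ((g⁻¹ : GL (Fin 2) ℝ) : Matrix (Fin 2) (Fin 2) ℝ)) := by
  rw [flow_coset] at h
  obtain ⟨γ, c, hc, e⟩ := coset_eq_iff.1 h.symm
  have e' : toReal γ = c⁻¹ • ((g : Matrix (Fin 2) (Fin 2) ℝ) * (geodesicMatrix T : Matrix _ _ ℝ) *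
        ((g⁻¹ : GL (Fin 2) ℝ) : Matrix (Fin 2) (Fin 2) ℝ)) := by
    rw [← Units.val_mul, e, smul_mul_assoc, smul_smul, inv_mul_cancel₀ hc, one_smul, mul_assoc,
      ← Units.val_mul, mul_inv_cancel, Units.val_one, mul_one]
  refine ⟨γ, c⁻¹, ?_, e'⟩
  have hd := congrArg Matrix.det e'
  have hgg : (g : Matrix (Fin 2) (Fin 2) ℝ).det *
      ((g⁻¹ : GL (Fin 2) ℝ) : Matrix (Fin 2) (Fin 2) ℝ).det = 1 := by
    rw [← det_mul, ← Units.val_mul, mul_inv_cancel, Units.val_one, det_one]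
  have hh : (geodesicMatrix T : Matrix (Fin 2) (Fin 2) ℝ).det = 1 := by
    rw [coe_geodesicMatrix, det_fin_two_of, ← Real.exp_add]
    simp; ring
  rw [toReal_det, det_smul, det_mul, det_mul, hh, mul_one, hgg, mul_one, Fintype.card_fin] at hd
  have hu : IsUnit (γ : Matrix (Fin 2) (Fin 2) ℤ).det := (Matrix.isUnit_iff_isUnit_det _).1 γ.isUnit
  -- The conjugate of the geodesic matrix has determinant 1, so det γ is a square; this excludes -1.
  rcases Int.isUnit_iff.1 hu with h1 | h1
  · rw [← hd, h1]; simp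
  · rw [h1] at hd
    push_cast at hd
    nlinarith [sq_nonneg c⁻¹]

theorem trace_conj_geodesicMatrix (g : GL (Fin 2) ℝ) (T : ℝ) :
    ((g : Matrix (Fin 2) (Fin 2) ℝ) * (geodesicMatrix T : Matrix _ _ ℝ) *
        ((g⁻¹ : GL (Fin 2) ℝ) : Matrix (Fin 2) (Fin 2) ℝ)).trace =
      Real.exp (T / 2) + Real.exp (-T / 2) := by
  rw [trace_mul_comm, ← mul_assoc, ← Units.val_mul, inv_mul_cancel, Units.val_one, one_mul,
    coe_geodesicMatrix, trace_fin_two_of]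

/-- A period T yields an integral matrix whose trace is ±2 cosh(T/2). For 0 < T < 1 its absolute
value would lie strictly between 2 and 3. -/
theorem one_le_of_flow_eq {x : X} {T : ℝ} (hT : 0 < T) (h : flow T x = x) : 1 ≤ T := by
  obtain ⟨g, rfl⟩ := exists_coset_mk x
  obtain ⟨γ, c, hc, e⟩ := exists_integral_of_flow_eq h
  have ht := congrArg Matrix.trace e
  rw [trace_smul, trace_conj_geodesicMatrix, smul_eq_mul] at ht
  have ht' : ((γ : Matrix (Fin 2) (Fin 2) ℤ).trace : ℝ) =
      c * (Real.exp (T / 2) + Real.exp (-T / 2)) := by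
    rw [← ht]; simp [trace_fin_two]
  set n := (γ : Matrix (Fin 2) (Fin 2) ℤ).trace
  have hsq : ((n ^ 2 : ℤ) : ℝ) = (Real.exp (T / 2) + Real.exp (-T / 2)) ^ 2 := by
    push_cast; rw [ht', mul_pow, hc, one_mul]
  by_contra! hlt
  have hprod : Real.exp (T / 2) * Real.exp (-T / 2) = 1 := by
    rw [← Real.exp_add]; simp; ring
  have h1 : 1 < Real.exp (T / 2) := Real.one_lt_exp_iff.2 (by linarith)
  have h2 : Real.exp (-T / 2) < 1 := by rw [← Real.exp_zero]; exact Real.exp_lt_exp.2 (by linarith)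
  have h3 : Real.exp (T / 2) < 2 := by
    have : Real.exp (T / 2) ^ 2 < 2.7182818286 := by
      rw [← Real.exp_nat_mul]
      refine (Real.exp_lt_exp.2 ?_).trans Real.exp_one_lt_d9
      push_cast; linarith
    nlinarith
  have hp := Real.exp_pos (-T / 2)
  have hlow : (4 : ℝ) < ((n ^ 2 : ℤ) : ℝ) := by
    rw [hsq]; nlinarith [sq_pos_of_pos (sub_pos.2 (h2.trans h1))]
  have hupp : ((n ^ 2 : ℤ) : ℝ) < 9 := by
    rw [hsq]; nlinarith
  have hl : 4 < n ^ 2 := by exact_mod_cast hlow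
  have hu : n ^ 2 < 9 := by exact_mod_cast hupp
  have a1 : n < 3 := by nlinarith
  have a2 : -3 < n := by nlinarith
  interval_cases n <;> simp at hl

theorem IsPeriodicOrbit.one_le_length {Y : Set X} (hY : IsPeriodicOrbit Y) : 1 ≤ length Y := by
  obtain ⟨T, hT⟩ := hY.exists_period
  obtain ⟨y, hy⟩ := hY.nonempty
  exact le_csInf ⟨T, hT⟩ fun S hS => one_le_of_flow_eq hS.1 (hS.2 y hy)

/-- A period close to the infimum replaces a least one; the error of 1 is harmless since lengths are
at least 1. -/
theorem IsPeriodicOrbit.exists_period_lt {Y : Set X} (hY : IsPeriodicOrbit Y) :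
    ∃ T : ℝ, 0 < T ∧ T < length Y + 1 ∧ ∀ y ∈ Y, flow T y = y := by
  obtain ⟨T, hT⟩ := hY.exists_period
  obtain ⟨S, hS, h⟩ := exists_lt_of_csInf_lt
    (s := {T : ℝ | 0 < T ∧ ∀ y ∈ Y, flow T y = y}) ⟨T, hT⟩ (lt_add_one (length Y))
  exact ⟨S, hS.1, h, hS.2⟩

/-! ### The sets `Ω'_δ` -/

/-- One representative suffices: GL₂(ℤ) maps nonzero integral row vectors to such vectors, and a
scalar c multiplies both sides by c². -/
theorem mem_Omega_iff {δ : ℝ} {g : GL (Fin 2) ℝ} :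
    coset (ProjGenLinGroup.mk g) ∈ Omega δ ↔ ∀ m : Fin 2 → ℤ, m ≠ 0 →
      δ * |(g : Matrix (Fin 2) (Fin 2) ℝ).det| ≤
        ‖(fun i => (m i : ℝ)) ᵥ* (g : Matrix (Fin 2) (Fin 2) ℝ)‖ ^ 2 := by
  refine ⟨fun h => h g rfl, fun h g' hg' m hm => ?_⟩
  obtain ⟨γ, c, hc, e⟩ := coset_eq_iff.1 hg'
  have hu : IsUnit (γ : Matrix (Fin 2) (Fin 2) ℤ).det := (Matrix.isUnit_iff_isUnit_det _).1 γ.isUnit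
  have hm' : m ᵥ* (γ : Matrix (Fin 2) (Fin 2) ℤ) ≠ 0 := fun h0 => by
    have : (m ᵥ* (γ : Matrix (Fin 2) (Fin 2) ℤ)) ᵥ* ((γ⁻¹ : GL (Fin 2) ℤ) : Matrix _ _ ℤ) = m := by
      rw [vecMul_vecMul, ← Units.val_mul, mul_inv_cancel, Units.val_one, vecMul_one]
    rw [h0, zero_vecMul] at this
    exact hm this.symm
  have key := h _ hm'
  have e1 : (fun i => (m i : ℝ)) ᵥ* (g' : Matrix (Fin 2) (Fin 2) ℝ) =
      c • ((fun i => ((m ᵥ* (γ : Matrix (Fin 2) (Fin 2) ℤ)) i : ℝ)) ᵥ*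
        (g : Matrix (Fin 2) (Fin 2) ℝ)) := by
    rw [e, vecMul_smul, ← vecMul_vecMul]
    congr 2
    ext i
    simp [vecMul, dotProduct]
  have hd : |((γ : Matrix (Fin 2) (Fin 2) ℤ).det : ℝ)| = 1 := by
    rcases Int.isUnit_iff.1 hu with h1 | h1 <;> simp [h1]
  rw [e1, e, norm_smul, det_smul, det_mul, toReal_det, mul_pow, abs_mul, abs_mul, hd, one_mul,
    Fintype.card_fin, abs_pow, Real.norm_eq_abs]
  nlinarith [sq_nonneg |c|]

theorem abs_mul_le_norm_sq (v : Fin 2 → ℝ) : |v 0 * v 1| ≤ ‖v‖ ^ 2 := by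
  rw [abs_mul, sq]
  exact mul_le_mul (norm_le_pi_norm v 0) (norm_le_pi_norm v 1) (abs_nonneg _) (norm_nonneg _)

/-- An orbit lies in `Ω'_δ` if the product of the coordinates is bounded below on its lattice. -/
theorem orbit_subset_Omega {δ : ℝ} {g : GL (Fin 2) ℝ}
    (h : ∀ m : Fin 2 → ℤ, m ≠ 0 → δ * |(g : Matrix (Fin 2) (Fin 2) ℝ).det| ≤
      |((fun i => (m i : ℝ)) ᵥ* (g : Matrix (Fin 2) (Fin 2) ℝ)) 0 *
        ((fun i => (m i : ℝ)) ᵥ* (g : Matrix (Fin 2) (Fin 2) ℝ)) 1|) :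
    orbit (coset (ProjGenLinGroup.mk g)) ⊆ Omega δ := by
  rintro _ ⟨t, rfl⟩
  simp only
  rw [flow_coset, mem_Omega_iff]
  intro m hm
  have hprod : Real.exp (t / 2) * Real.exp (-t / 2) = 1 := by
    rw [← Real.exp_add]; simp; ring
  have hh : (geodesicMatrix t : Matrix (Fin 2) (Fin 2) ℝ).det = 1 := by
    rw [coe_geodesicMatrix, det_fin_two_of, hprod]; simp
  rw [Units.val_mul, det_mul, hh, mul_one, ← vecMul_vecMul]
  -- The flow scales the two coordinates by inverse factors, so their product is constant along the
  -- orbit.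
  refine (h m hm).trans (le_trans (le_of_eq ?_) (abs_mul_le_norm_sq _))
  set v := (fun i => (m i : ℝ)) ᵥ* (g : Matrix (Fin 2) (Fin 2) ℝ)
  congr 1
  rw [coe_geodesicMatrix]
  simp only [vecMul, dotProduct, Fin.sum_univ_two, of_apply, cons_val', cons_val_zero,
    cons_val_one, cons_val_fin_one, mul_zero, add_zero, zero_add]
  linear_combination -(v 0 * v 1) * hprod

/-! ### Reduction theory and compactness -/

theorem finite_integral_matrices (B : ℝ) :
    {M : Matrix (Fin 2) (Fin 2) ℤ | ∀ i j, |(M i j : ℝ)| ≤ B}.Finite := by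
  have hfin : {n : ℤ | |(n : ℝ)| ≤ B}.Finite := by
    refine (Set.finite_Icc (-⌈B⌉) ⌈B⌉).subset fun n hn => ?_
    rw [Set.mem_ofPred_eq, abs_le] at hn
    have hB := Int.le_ceil B
    constructor
    · have : ((-⌈B⌉ : ℤ) : ℝ) ≤ n := by push_cast; linarith
      exact_mod_cast this
    · have : (n : ℝ) ≤ ⌈B⌉ := by linarith
      exact_mod_cast this
  exact (Set.Finite.pi' fun _ : Fin 2 => Set.Finite.pi' fun _ : Fin 2 => hfin).subset fun M hM => hM

theorem abs_mul_apply_le {A A' : Matrix (Fin 2) (Fin 2) ℝ} {C C' : ℝ} (hA : ∀ i j, |A i j| ≤ C)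
    (hA' : ∀ i j, |A' i j| ≤ C') (i j : Fin 2) : |(A * A') i j| ≤ 2 * (C * C') := by
  have hC : 0 ≤ C := (abs_nonneg _).trans (hA 0 0)
  rw [mul_apply, Fin.sum_univ_two]
  refine (abs_add_le _ _).trans ?_
  rw [abs_mul, abs_mul, two_mul]
  exact add_le_add (mul_le_mul (hA _ _) (hA' _ _) (abs_nonneg _) hC)
    (mul_le_mul (hA _ _) (hA' _ _) (abs_nonneg _) hC)

theorem exists_abs_apply_le (A : Matrix (Fin 2) (Fin 2) ℝ) : ∃ C, ∀ i j, |A i j| ≤ C := by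
  refine ⟨∑ i, ∑ j, |A i j|, fun i j => ?_⟩
  refine le_trans ?_ (Finset.single_le_sum (f := fun i => ∑ j, |A i j|)
    (fun i _ => Finset.sum_nonneg fun j _ => abs_nonneg _) (Finset.mem_univ i))
  exact Finset.single_le_sum (f := fun j => |A i j|) (fun j _ => abs_nonneg _) (Finset.mem_univ j)

/-- The sum of the squares of the entries. -/
def entrySq (A : Matrix (Fin 2) (Fin 2) ℝ) : ℝ :=
  A 0 0 ^ 2 + A 0 1 ^ 2 + (A 1 0 ^ 2 + A 1 1 ^ 2)

theorem abs_apply_le_sqrt_entrySq (A : Matrix (Fin 2) (Fin 2) ℝ) (i j : Fin 2) :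
    |A i j| ≤ √(entrySq A) := by
  refine Real.abs_le_sqrt ?_
  have h00 := sq_nonneg (A 0 0)
  have h01 := sq_nonneg (A 0 1)
  have h10 := sq_nonneg (A 1 0)
  have h11 := sq_nonneg (A 1 1)
  fin_cases i <;> fin_cases j <;> simp [entrySq] <;> linarith

/-- Sublevel sets are finite: γ = (γ g) g⁻¹ has bounded entries when γ g does. -/
theorem exists_minimal_entrySq (g : SL(2, ℝ)) :
    ∃ γ : SL(2, ℤ), ∀ γ' : SL(2, ℤ), entrySq (toReal γ * g) ≤ entrySq (toReal γ' * g) := by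
  set f : SL(2, ℤ) → ℝ := fun γ => entrySq (toReal γ * g) with hf
  have hfin : {γ : SL(2, ℤ) | f γ ≤ f 1}.Finite := by
    obtain ⟨C, hC⟩ := exists_abs_apply_le ((g⁻¹ : SL(2, ℝ)) : Matrix (Fin 2) (Fin 2) ℝ)
    refine Set.Finite.of_finite_image (f := fun γ : SL(2, ℤ) => (γ : Matrix (Fin 2) (Fin 2) ℤ))
      ((finite_integral_matrices (2 * (√(f 1) * C))).subset ?_)
      (fun a _ b _ h => Subtype.ext h)
    rintro _ ⟨γ, hγ, rfl⟩ i j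
    have : toReal γ = (toReal γ * g) * ((g⁻¹ : SL(2, ℝ)) : Matrix (Fin 2) (Fin 2) ℝ) := by
      have h1 : (g : Matrix (Fin 2) (Fin 2) ℝ) * ((g⁻¹ : SL(2, ℝ)) : Matrix (Fin 2) (Fin 2) ℝ) =
          1 := congrArg Subtype.val (mul_inv_cancel g)
      rw [mul_assoc, h1, mul_one]
    have e : ((γ i j : ℤ) : ℝ) = toReal γ i j := rfl
    rw [e, this]
    exact abs_mul_apply_le
      (fun i j => (abs_apply_le_sqrt_entrySq _ i j).trans (Real.sqrt_le_sqrt hγ)) hC i j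
  obtain ⟨γ, hγ, hmin⟩ := Set.exists_min_image _ f hfin ⟨1, le_refl (f 1)⟩
  refine ⟨γ, fun γ' => ?_⟩
  rcases le_or_gt (f γ') (f 1) with h | h
  · exact hmin γ' h
  · exact le_trans hγ h.le

theorem exists_coset_toGL (x : X) :
    ∃ g : SL(2, ℝ), x = coset (ProjGenLinGroup.mk (SpecialLinearGroup.toGL g)) := by
  obtain ⟨g, rfl⟩ := exists_coset_mk x
  have hu : (g : Matrix (Fin 2) (Fin 2) ℝ).det ≠ 0 := g.det_ne_zero
  set d := (g : Matrix (Fin 2) (Fin 2) ℝ).det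
  have hs : (√|d|)⁻¹ ^ 2 * |d| = 1 := by
    rw [inv_pow, Real.sq_sqrt (abs_nonneg d), inv_mul_cancel₀ (abs_ne_zero.2 hu)]
  have hs0 : (√|d|)⁻¹ ≠ 0 := inv_ne_zero (Real.sqrt_ne_zero'.2 (abs_pos.2 hu))
  obtain ⟨γ, hγ⟩ : ∃ γ : GL (Fin 2) ℤ, ((γ : Matrix (Fin 2) (Fin 2) ℤ).det : ℝ) * d = |d| := by
    rcases le_total 0 d with h | h
    · exact ⟨1, by simp [abs_of_nonneg h]⟩
    · refine ⟨⟨!![1, 0; 0, -1], !![1, 0; 0, -1], ?_, ?_⟩, ?_⟩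
      · ext i j; fin_cases i <;> fin_cases j <;> simp
      · ext i j; fin_cases i <;> fin_cases j <;> simp
      · simp [abs_of_nonpos h]
  refine ⟨⟨(√|d|)⁻¹ • (toReal γ * (g : Matrix (Fin 2) (Fin 2) ℝ)), ?_⟩,
    coset_eq_iff.2 ⟨γ, _, hs0, rfl⟩⟩
  rw [det_smul, det_mul, toReal_det, Fintype.card_fin, hγ, hs]

theorem coset_toGL_eq (γ : SL(2, ℤ)) {g g' : SL(2, ℝ)}
    (h : (g' : Matrix (Fin 2) (Fin 2) ℝ) = toReal γ * g) :
    coset (ProjGenLinGroup.mk (SpecialLinearGroup.toGL g)) =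
      coset (ProjGenLinGroup.mk (SpecialLinearGroup.toGL g')) :=
  coset_eq_iff.2 ⟨SpecialLinearGroup.toGL γ, 1, one_ne_zero, by rw [one_smul]; exact h⟩

theorem norm_sq_le (v : Fin 2 → ℝ) : ‖v‖ ^ 2 ≤ v 0 ^ 2 + v 1 ^ 2 := by
  have h : ‖v‖ ≤ √(v 0 ^ 2 + v 1 ^ 2) := by
    refine (pi_norm_le_iff_of_nonneg (Real.sqrt_nonneg _)).2 fun i => Real.abs_le_sqrt ?_
    have := sq_nonneg (v 0)
    have := sq_nonneg (v 1)
    fin_cases i <;> simp <;> linarith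
  calc ‖v‖ ^ 2 ≤ √(v 0 ^ 2 + v 1 ^ 2) ^ 2 := by gcongr
    _ = _ := Real.sq_sqrt (by positivity)

/-- Every point of `Ω'_δ` has a representative of determinant one with bounded entries. -/
theorem exists_reduced {δ : ℝ} (hδ : 0 < δ) {x : X} (hx : x ∈ Omega δ) :
    ∃ g : SL(2, ℝ), x = coset (ProjGenLinGroup.mk (SpecialLinearGroup.toGL g)) ∧
      ∀ i j, g i j ^ 2 ≤ 4 / (3 * δ) := by
  obtain ⟨g₀, rfl⟩ := exists_coset_toGL x
  obtain ⟨γ, hγ⟩ := exists_minimal_entrySq g₀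
  set g : SL(2, ℝ) := ⟨toReal γ * g₀, by rw [det_mul, toReal_det, γ.2, g₀.2]; simp⟩ with hg
  have e : coset (ProjGenLinGroup.mk (SpecialLinearGroup.toGL g₀)) =
      coset (ProjGenLinGroup.mk (SpecialLinearGroup.toGL g)) := coset_toGL_eq γ rfl
  refine ⟨g, e, ?_⟩
  rw [e, mem_Omega_iff] at hx
  have hcmp : ∀ η : SL(2, ℤ), entrySq g ≤ entrySq (toReal η * g) := by
    intro η
    have := hγ (η * γ)
    have h1 : ((η * γ : SL(2, ℤ)) : Matrix (Fin 2) (Fin 2) ℤ) =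
        (η : Matrix (Fin 2) (Fin 2) ℤ) * (γ : Matrix (Fin 2) (Fin 2) ℤ) := rfl
    rw [h1, toReal_mul, mul_assoc] at this
    exact this
  have hdet : (g : Matrix (Fin 2) (Fin 2) ℝ).det = 1 := g.2
  have hcoe : ((SpecialLinearGroup.toGL g : GL (Fin 2) ℝ) : Matrix (Fin 2) (Fin 2) ℝ) = g := rfl
  rw [hcoe, hdet, abs_one, mul_one] at hx
  have r0 := (hx ![1, 0] (by simp)).trans (norm_sq_le _)
  have r1 := (hx ![0, 1] (by simp)).trans (norm_sq_le _)
  -- Minimality against these four elementary matrices says that the rows u, v of g satisfy 2|⟨u,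
  -- v⟩| ≤ min(|u|², |v|²).
  have c1 := hcmp ⟨!![1, 1; 0, 1], by simp⟩
  have c2 := hcmp ⟨!![1, -1; 0, 1], by simp⟩
  have c3 := hcmp ⟨!![1, 0; 1, 1], by simp⟩
  have c4 := hcmp ⟨!![1, 0; -1, 1], by simp⟩
  rw [det_fin_two] at hdet
  simp [vecMul, dotProduct, Fin.sum_univ_two] at r0 r1
  simp [entrySq, toReal, mul_apply, Fin.sum_univ_two] at c1 c2 c3 c4
  clear_value g
  simp only [Fin.forall_fin_two]
  generalize (g : Matrix (Fin 2) (Fin 2) ℝ) 0 0 = a at *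
  generalize (g : Matrix (Fin 2) (Fin 2) ℝ) 0 1 = b at *
  generalize (g : Matrix (Fin 2) (Fin 2) ℝ) 1 0 = c at *
  generalize (g : Matrix (Fin 2) (Fin 2) ℝ) 1 1 = d at *
  -- By Lagrange's identity |u|²|v|² = ⟨u, v⟩² + 1, and ⟨u, v⟩² is at most a quarter of the left
  -- side. Each row has square length at least δ, which then bounds the other one.
  have huv : 3 * ((a ^ 2 + b ^ 2) * (c ^ 2 + d ^ 2)) ≤ 4 := by
    have h1 : (2 * (a * c + b * d)) ^ 2 ≤ (a ^ 2 + b ^ 2) * (c ^ 2 + d ^ 2) := by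
      rw [← sq_abs, sq]
      have h : ∀ t, -(2 * (a * c + b * d)) ≤ t → 2 * (a * c + b * d) ≤ t →
          |2 * (a * c + b * d)| ≤ t := fun t h h' => abs_le'.2 ⟨h', h⟩
      exact mul_le_mul (h _ (by linarith) (by linarith)) (h _ (by linarith) (by linarith))
        (abs_nonneg _) (by positivity)
    linear_combination h1 + 4 * (a * d - b * c + 1) * hdet
  have hu : a ^ 2 + b ^ 2 ≤ 4 / (3 * δ) := by
    rw [le_div_iff₀ (by positivity)]
    nlinarith [mul_le_mul_of_nonneg_left r1 (show 0 ≤ a ^ 2 + b ^ 2 by positivity)]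
  have hv : c ^ 2 + d ^ 2 ≤ 4 / (3 * δ) := by
    rw [le_div_iff₀ (by positivity)]
    nlinarith [mul_le_mul_of_nonneg_left r0 (show 0 ≤ c ^ 2 + d ^ 2 by positivity)]
  refine ⟨⟨?_, ?_⟩, ?_, ?_⟩ <;> nlinarith [sq_nonneg a, sq_nonneg b, sq_nonneg c, sq_nonneg d]

theorem continuous_coset_toGL : Continuous fun g : SL(2, ℝ) =>
    coset (ProjGenLinGroup.mk (SpecialLinearGroup.toGL g)) := by
  have h1 : Continuous (ProjGenLinGroup.mk : GL (Fin 2) ℝ → PGL(2, ℝ)) := continuous_coinduced_rng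
  have h2 : Continuous coset := continuous_quotient_mk'
  exact h2.comp (h1.comp SpecialLinearGroup.continuous_toGL)

/-- The set is the continuous image of the bounded matrices of SL₂(ℝ) satisfying the closed
conditions indexed by m. -/
theorem isCompact_Omega {δ : ℝ} (hδ : 0 < δ) : IsCompact (Omega δ) := by
  set B : ℝ := √(4 / (3 * δ))
  set K : Set (Matrix (Fin 2) (Fin 2) ℝ) :=
    {A | (∀ i j, A i j ∈ Set.Icc (-B) B) ∧ ∀ m : Fin 2 → ℤ, m ≠ 0 →
      δ ≤ ‖(fun i => (m i : ℝ)) ᵥ* A‖ ^ 2}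
  have hK : IsCompact K := by
    have hbox : IsCompact {A : Matrix (Fin 2) (Fin 2) ℝ | ∀ i j, A i j ∈ Set.Icc (-B) B} := by
      have := isCompact_univ_pi fun _ : Fin 2 => isCompact_univ_pi fun _ : Fin 2 =>
        isCompact_Icc (a := -B) (b := B)
      simpa [Set.pi] using! this
    refine hbox.inter_right (t := {A | ∀ m : Fin 2 → ℤ, m ≠ 0 →
      δ ≤ ‖(fun i => (m i : ℝ)) ᵥ* A‖ ^ 2}) ?_
    simp only [Set.ofPred_forall]
    refine isClosed_iInter fun m => isClosed_iInter fun _ => isClosed_le continuous_const ?_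
    fun_prop
  have hK' := (SpecialLinearGroup.isClosedEmbedding_val (n := Fin 2) (R := ℝ)).isCompact_preimage hK
  have himage : Omega δ = (fun g : SL(2, ℝ) =>
      coset (ProjGenLinGroup.mk (SpecialLinearGroup.toGL g))) '' (Subtype.val ⁻¹' K) := by
    have hdet (g : SL(2, ℝ)) : |(SpecialLinearGroup.toGL g : Matrix (Fin 2) (Fin 2) ℝ).det| = 1 := by
      have : (SpecialLinearGroup.toGL g : Matrix (Fin 2) (Fin 2) ℝ).det = 1 := g.2
      rw [this, abs_one]
    ext x
    constructor
    · intro hx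
      obtain ⟨g, rfl, hg⟩ := exists_reduced hδ hx
      refine ⟨g, ⟨fun i j => abs_le.1 (Real.abs_le_sqrt (hg i j)), fun m hm => ?_⟩, rfl⟩
      have := mem_Omega_iff.1 hx m hm
      rw [hdet, mul_one] at this
      exact this
    · rintro ⟨g, hg, rfl⟩
      refine mem_Omega_iff.2 fun m hm => ?_
      rw [hdet, mul_one]
      exact hg.2 m hm
  rw [himage]
  exact hK'.image continuous_coset_toGL

/-! ### Discriminants -/

/-- The discriminant `tr(M)² - 4 det(M)` of the form `matrixForm M`. -/
def matrixDisc (M : Matrix (Fin 2) (Fin 2) ℤ) : ℤ := M.trace ^ 2 - 4 * M.det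

theorem Ad_mkQ (g : GL (Fin 2) ℝ) (A : Matrix (Fin 2) (Fin 2) ℝ) :
    Ad g (scalars.mkQ A) = scalars.mkQ ((g : Matrix (Fin 2) (Fin 2) ℝ) * A *
      ((g⁻¹ : GL (Fin 2) ℝ) : Matrix (Fin 2) (Fin 2) ℝ)) := by
  rw [mul_assoc]; rfl

theorem form_mkQ (A B : Matrix (Fin 2) (Fin 2) ℝ) :
    form (scalars.mkQ A) (scalars.mkQ B) = 2 * (A * B).trace - A.trace * B.trace := rfl

theorem form_self_mkQ (A : Matrix (Fin 2) (Fin 2) ℝ) :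
    form (scalars.mkQ A) (scalars.mkQ A) = A.trace ^ 2 - 4 * A.det := by
  rw [form_mkQ]
  simp only [trace_fin_two, det_fin_two, mul_apply, Fin.sum_univ_two]
  ring

theorem form_toReal (M : Matrix (Fin 2) (Fin 2) ℤ) :
    form (scalars.mkQ (toReal M)) (scalars.mkQ (toReal M)) = matrixDisc M := by
  rw [form_self_mkQ, toReal_det, matrixDisc]
  simp [trace_fin_two]

/-- Modulo scalars the diagonal matrices form a line, spanned by any non-scalar one. -/
theorem mem_map_Ad_cartan {g : GL (Fin 2) ℝ} {l₁ l₂ : ℝ} (hl : l₁ ≠ l₂) {w : LieAlg}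
    (hw : w ∈ Submodule.map (Ad g) cartan) :
    ∃ c : ℝ, w = c • scalars.mkQ ((g : Matrix (Fin 2) (Fin 2) ℝ) * !![l₁, 0; 0, l₂] *
      ((g⁻¹ : GL (Fin 2) ℝ) : Matrix (Fin 2) (Fin 2) ℝ)) := by
  obtain ⟨_, ⟨_, ⟨d, rfl⟩, rfl⟩, rfl⟩ := hw
  have hl' : l₁ - l₂ ≠ 0 := sub_ne_zero.2 hl
  refine ⟨(d 0 - d 1) / (l₁ - l₂), ?_⟩
  rw [← Ad_mkQ, ← map_smul, ← map_smul]
  congr 1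
  rw [← sub_eq_zero, ← map_sub, Submodule.mkQ_apply, Submodule.Quotient.mk_eq_zero, scalars,
    Submodule.mem_span_singleton]
  refine ⟨(d 1 * l₁ - d 0 * l₂) / (l₁ - l₂), ?_⟩
  ext i j
  fin_cases i <;> fin_cases j <;> simp <;> field_simp <;> ring

theorem mem_map_Ad_cartan_of_diag (g : GL (Fin 2) ℝ) (l₁ l₂ : ℝ) :
    scalars.mkQ ((g : Matrix (Fin 2) (Fin 2) ℝ) * !![l₁, 0; 0, l₂] *
      ((g⁻¹ : GL (Fin 2) ℝ) : Matrix (Fin 2) (Fin 2) ℝ)) ∈ Submodule.map (Ad g) cartan := by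
  rw [← Ad_mkQ]
  refine ⟨_, ⟨_, ⟨![l₁, l₂], rfl⟩, rfl⟩, ?_⟩
  congr 2
  ext i j
  fin_cases i <;> fin_cases j <;> simp

/-- The class x of M spans the line and B(x, x) = `matrixDisc M`; the expression is homogeneous of
degree 0 in w, so it equals x ⊗ x. -/
theorem integral_multiple_mem_tensorLatticeZ {g : GL (Fin 2) ℝ} {M : Matrix (Fin 2) (Fin 2) ℤ}
    {l₁ l₂ : ℝ} (hl : l₁ ≠ l₂)
    (hM : toReal M = (g : Matrix (Fin 2) (Fin 2) ℝ) * !![l₁, 0; 0, l₂] *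
      ((g⁻¹ : GL (Fin 2) ℝ) : Matrix (Fin 2) (Fin 2) ℝ)) {n : ℕ} (hn : 0 < n)
    (hnM : (n : ℤ) = matrixDisc M) {w : LieAlg} (hw : w ∈ Submodule.map (Ad g) cartan)
    (hw0 : w ≠ 0) :
    (n : ℝ) • ((form w w)⁻¹ • (w ⊗ₜ[ℝ] w)) ∈ tensorLatticeZ := by
  obtain ⟨c, rfl⟩ := mem_map_Ad_cartan hl hw
  rw [← hM] at hw0 ⊢
  have hc : c ≠ 0 := by rintro rfl; simp at hw0
  have hn0 : (n : ℝ) ≠ 0 := by exact_mod_cast hn.ne'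
  have hd : ((matrixDisc M : ℤ) : ℝ) = n := by rw [← hnM]; simp
  have : (n : ℝ) • ((form (c • scalars.mkQ (toReal M)) (c • scalars.mkQ (toReal M)))⁻¹ •
      ((c • scalars.mkQ (toReal M)) ⊗ₜ[ℝ] (c • scalars.mkQ (toReal M)))) =
      scalars.mkQ (toReal M) ⊗ₜ[ℝ] scalars.mkQ (toReal M) := by
    rw [map_smul, map_smul, LinearMap.smul_apply, form_toReal, hd, TensorProduct.smul_tmul_smul,
      smul_smul, smul_smul, smul_eq_mul, smul_eq_mul]
    convert one_smul ℝ _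
    field_simp
  rw [this]
  exact AddSubgroup.subset_closure ⟨_, ⟨M, rfl⟩, _, ⟨M, rfl⟩, rfl⟩

theorem disc_le {g : GL (Fin 2) ℝ} {M : Matrix (Fin 2) (Fin 2) ℤ}
    {l₁ l₂ : ℝ} (hl : l₁ ≠ l₂)
    (hM : toReal M = (g : Matrix (Fin 2) (Fin 2) ℝ) * !![l₁, 0; 0, l₂] *
      ((g⁻¹ : GL (Fin 2) ℝ) : Matrix (Fin 2) (Fin 2) ℝ)) (hpos : 0 < matrixDisc M) :
    (disc (orbit (coset (ProjGenLinGroup.mk g))) : ℤ) ≤ matrixDisc M := by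
  obtain ⟨n, hn⟩ := Int.eq_ofNat_of_zero_le hpos.le
  have hn0 : 0 < n := by lia
  rw [hn]
  have h1 : disc (orbit (coset (ProjGenLinGroup.mk g))) ≤
      cartanDisc (Submodule.map (Ad g) cartan) := Nat.sInf_le ⟨g, mem_orbit_self _, rfl⟩
  have h2 : cartanDisc (Submodule.map (Ad g) cartan) ≤ n := Nat.sInf_le
    ⟨hn0, fun w hw hw0 => integral_multiple_mem_tensorLatticeZ hl hM hn0 hn.symm hw hw0⟩
  exact_mod_cast h1.trans h2

/-- The discriminant of a periodic orbit is positive and attained. -/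
theorem cartanDisc_spec {g : GL (Fin 2) ℝ} {T : ℝ} (hT : 0 < T)
    (h : flow T (coset (ProjGenLinGroup.mk g)) = coset (ProjGenLinGroup.mk g)) :
    0 < cartanDisc (Submodule.map (Ad g) cartan) ∧
      ∀ w ∈ Submodule.map (Ad g) cartan, w ≠ 0 →
        (cartanDisc (Submodule.map (Ad g) cartan) : ℝ) • ((form w w)⁻¹ • (w ⊗ₜ[ℝ] w)) ∈
          tensorLatticeZ := by
  obtain ⟨γ, c, hc, e⟩ := exists_integral_of_flow_eq h
  have hc0 : c ≠ 0 := by rintro rfl; simp at hc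
  have e' : toReal γ = (g : Matrix (Fin 2) (Fin 2) ℝ) *
      !![c * Real.exp (T / 2), 0; 0, c * Real.exp (-T / 2)] *
      ((g⁻¹ : GL (Fin 2) ℝ) : Matrix (Fin 2) (Fin 2) ℝ) := by
    rw [e, coe_geodesicMatrix, ← smul_mul_assoc, ← mul_smul_comm]
    congr 2
    ext i j
    fin_cases i <;> fin_cases j <;> simp
  have hlt : Real.exp (-T / 2) < Real.exp (T / 2) := Real.exp_lt_exp.2 (by linarith)
  have hprod : Real.exp (T / 2) * Real.exp (-T / 2) = 1 := by
    rw [← Real.exp_add]; simp; ring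
  have hpos : 0 < matrixDisc γ := by
    have : ((matrixDisc γ : ℤ) : ℝ) = (Real.exp (T / 2) - Real.exp (-T / 2)) ^ 2 := by
      rw [← form_toReal, form_self_mkQ, e, trace_smul, trace_conj_geodesicMatrix, ← e, toReal_det]
      have hd : (((γ : Matrix (Fin 2) (Fin 2) ℤ).det : ℤ) : ℝ) = 1 := by
        rw [← toReal_det, e', mul_assoc, det_mul_comm, mul_assoc, ← Units.val_mul, inv_mul_cancel,
          Units.val_one, mul_one, det_fin_two_of]
        linear_combination c ^ 2 * hprod + hc
      rw [hd, smul_eq_mul, mul_pow, hc]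
      linear_combination 4 * hprod
    have h0 : (0 : ℝ) < (matrixDisc γ : ℤ) := by
      rw [this]; exact sq_pos_of_pos (sub_pos.2 hlt)
    exact_mod_cast h0
  obtain ⟨n, hn⟩ := Int.eq_ofNat_of_zero_le hpos.le
  have hn0 : 0 < n := by lia
  -- The infimum of an empty set would be 0; the matrix of the period supplies an admissible n.
  exact Nat.sInf_mem (s := {n : ℕ | 0 < n ∧ ∀ w ∈ Submodule.map (Ad g) cartan, w ≠ 0 →
    (n : ℝ) • ((form w w)⁻¹ • (w ⊗ₜ[ℝ] w)) ∈ tensorLatticeZ})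
    ⟨n, hn0, fun w hw hw0 => integral_multiple_mem_tensorLatticeZ
      (fun h => hlt.ne' (mul_left_cancel₀ hc0 h)) e' hn0 hn.symm hw hw0⟩

/-! ### Finiteness -/

/-- The square of a functional that is integral on the lattice of `𝔤` is integral on that of
`𝔤 ⊗ 𝔤`. -/
theorem exists_int_of_mem_tensorLatticeZ {ψ : LieAlg →ₗ[ℝ] ℝ}
    (hψ : ∀ v ∈ latticeZ, ∃ k : ℤ, ψ v = k) {v : LieAlg ⊗[ℝ] LieAlg} (hv : v ∈ tensorLatticeZ) :
    ∃ k : ℤ, LinearMap.mul' ℝ ℝ (TensorProduct.map ψ ψ v) = k := by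
  induction hv using AddSubgroup.closure_induction with
  | mem v hv =>
    obtain ⟨x, hx, y, hy, rfl⟩ := hv
    obtain ⟨k, hk⟩ := hψ x hx
    obtain ⟨l, hl⟩ := hψ y hy
    exact ⟨k * l, by simp [hk, hl]⟩
  | zero => exact ⟨0, by simp⟩
  | add v w _ _ hv hw =>
    obtain ⟨k, hk⟩ := hv
    obtain ⟨l, hl⟩ := hw
    exact ⟨k + l, by rw [map_add, map_add, hk, hl]; simp⟩
  | neg v _ hv =>
    obtain ⟨k, hk⟩ := hv
    exact ⟨-k, by rw [map_neg, map_neg, hk]; simp⟩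

/-- The functional on `𝔤` induced by a linear form on matrices vanishing on scalars. -/
def coordinate (f : Matrix (Fin 2) (Fin 2) ℝ →ₗ[ℝ] ℝ) (hf : f 1 = 0) : LieAlg →ₗ[ℝ] ℝ :=
  scalars.liftQ f (by rw [scalars, Submodule.span_le, Set.singleton_subset_iff]; exact hf)

theorem finite_bounded_sq (D B : ℝ) :
    {z : ℝ | |z| ≤ B ∧ ∃ n : ℕ, 0 < n ∧ (n : ℝ) ≤ D ∧ ∃ k : ℤ, n * z ^ 2 = k}.Finite := by
  have hfin : (⋃ n ∈ Set.Iic ⌊D⌋₊, ⋃ k ∈ Set.Icc (0 : ℤ) ⌊D * B ^ 2⌋,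
      ({√((k : ℝ) / n), -√((k : ℝ) / n)} : Set ℝ)).Finite :=
    (Set.finite_Iic _).biUnion fun n _ => (Set.finite_Icc _ _).biUnion fun k _ => by simp
  refine hfin.subset ?_
  rintro z ⟨hz, n, hn, hnD, k, hk⟩
  have hn0 : (0 : ℝ) < n := by exact_mod_cast hn
  have hz2 : z ^ 2 ≤ B ^ 2 := by rw [← sq_abs]; gcongr
  simp only [Set.mem_iUnion]
  refine ⟨n, Nat.le_floor hnD, k, ⟨?_, ?_⟩, ?_⟩
  · have : (0 : ℝ) ≤ k := by rw [← hk]; positivity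
    exact_mod_cast this
  · refine Int.le_floor.2 ?_
    rw [← hk]
    exact mul_le_mul hnD hz2 (sq_nonneg z) (hn0.le.trans hnD)
  · have : (k : ℝ) / n = z ^ 2 := by rw [← hk]; field_simp
    rw [this, Real.sqrt_sq_eq_abs]
    rcases abs_choice z with h | h <;> simp [h]

/-- The orbit of `Γ g` is determined by the conjugate of the diagonal subgroup by `g`. -/
theorem orbit_eq_of_products_eq {g g' : SL(2, ℝ)} (h1 : g 0 0 * g 0 1 = g' 0 0 * g' 0 1)
    (h2 : g 1 0 * g 1 1 = g' 1 0 * g' 1 1)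
    (h3 : g 0 0 * g 1 1 + g 0 1 * g 1 0 = g' 0 0 * g' 1 1 + g' 0 1 * g' 1 0) :
    orbit (coset (ProjGenLinGroup.mk (SpecialLinearGroup.toGL g))) =
      orbit (coset (ProjGenLinGroup.mk (SpecialLinearGroup.toGL g'))) := by
  have hd : g 0 0 * g 1 1 - g 0 1 * g 1 0 = 1 := by rw [← det_fin_two]; exact g.2
  have hd' : g' 0 0 * g' 1 1 - g' 0 1 * g' 1 0 = 1 := by rw [← det_fin_two]; exact g'.2
  -- The three products give the entries of g diag(1,-1) g⁻¹, so g⁻¹g' commutes with diag(1,-1): its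
  -- off-diagonal entries `k01` and `k10` vanish, and t, u are its diagonal entries.
  set t := g 1 1 * g' 0 0 - g 0 1 * g' 1 0 with ht
  set u := g 0 0 * g' 1 1 - g 1 0 * g' 0 1 with hu
  have had : g 0 0 * g 1 1 = g' 0 0 * g' 1 1 := by linarith
  have hbc : g 0 1 * g 1 0 = g' 0 1 * g' 1 0 := by linarith
  have k01 : g 1 1 * g' 0 1 - g 0 1 * g' 1 1 = 0 := by
    have e1 : (g 1 1 * g' 0 1 - g 0 1 * g' 1 1) * g' 0 0 = 0 := by
      linear_combination - g 1 1 * h1 + g 0 1 * had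
    have e2 : (g 1 1 * g' 0 1 - g 0 1 * g' 1 1) * g' 1 0 = 0 := by
      linear_combination - g 1 1 * hbc + g 0 1 * h2
    linear_combination (-(g 1 1 * g' 0 1 - g 0 1 * g' 1 1)) * hd' + g' 1 1 * e1 - g' 0 1 * e2
  have k10 : g 0 0 * g' 1 0 - g 1 0 * g' 0 0 = 0 := by
    have e1 : (g 0 0 * g' 1 0 - g 1 0 * g' 0 0) * g' 0 1 = 0 := by
      linear_combination - g 0 0 * hbc + g 1 0 * h1
    have e2 : (g 0 0 * g' 1 0 - g 1 0 * g' 0 0) * g' 1 1 = 0 := by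
      linear_combination - g 0 0 * h2 + g 1 0 * had
    linear_combination (-(g 0 0 * g' 1 0 - g 1 0 * g' 0 0)) * hd' + g' 0 0 * e2 - g' 1 0 * e1
  have htu : t * u = 1 := by
    linear_combination (g 0 0 * g 1 1 - g 0 1 * g 1 0) * hd' + hd +
      (g 0 0 * g' 1 0 - g 1 0 * g' 0 0) * k01
  have ht0 : t ≠ 0 := left_ne_zero_of_mul_eq_one htu
  have a' : g' 0 0 = t * g 0 0 := by linear_combination (-g' 0 0) * hd + g 0 1 * k10
  have c' : g' 1 0 = t * g 1 0 := by linear_combination (-g' 1 0) * hd + g 1 1 * k10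
  have b' : g' 0 1 = u * g 0 1 := by linear_combination (-g' 0 1) * hd + g 0 0 * k01
  have d' : g' 1 1 = u * g 1 1 := by linear_combination (-g' 1 1) * hd + g 1 0 * k01
  have hu' : u = t⁻¹ := eq_inv_of_mul_eq_one_right htu
  refine (orbit_eq_of_mem ⟨2 * Real.log |t|, ?_⟩).symm
  simp only
  rw [flow_coset, coset_eq_iff]
  have hE : Real.exp (2 * Real.log |t| / 2) = |t| := by
    rw [mul_div_cancel_left₀ _ two_ne_zero, Real.exp_log (abs_pos.2 ht0)]
  have hE' : Real.exp (-(2 * Real.log |t|) / 2) = |t|⁻¹ := by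
    rw [neg_div, Real.exp_neg, hE]
  -- The flow realises diag(|t|, |t|⁻¹); the sign of t is absorbed by the centre.
  refine ⟨1, t / |t|, div_ne_zero ht0 (abs_ne_zero.2 ht0), ?_⟩
  have h0 : toReal ((1 : GL (Fin 2) ℤ) : Matrix (Fin 2) (Fin 2) ℤ) = 1 := by
    ext i j; fin_cases i <;> fin_cases j <;> simp
  rw [h0, one_mul, Units.val_mul, coe_geodesicMatrix, hE, hE']
  have hab : |t| ≠ 0 := abs_ne_zero.2 ht0
  have hsq : |t| * |t| = t * t := abs_mul_abs_self t
  ext i j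
  fin_cases i <;> fin_cases j <;> simp [mul_apply, Fin.sum_univ_two, a', b', c', d', hu']
  all_goals field_simp
  all_goals rw [sq_abs, mul_comm]

/-- Moves integrality from the representative g to a reduced one g'. For w the class of g diag(1,-1)
g⁻¹ one has B(w, w) = 4, and f ∘ Ad(γ) is integral on the lattice, so its tensor square is integral
at n w ⊗ w / 4. -/
theorem exists_int_of_coordinate {f : Matrix (Fin 2) (Fin 2) ℝ →ₗ[ℝ] ℝ} (hf : f 1 = 0)
    (hfZ : ∀ M : Matrix (Fin 2) (Fin 2) ℤ, ∃ k : ℤ, f (toReal M) = k)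
    {g g' : GL (Fin 2) ℝ} {γ : GL (Fin 2) ℤ} {c : ℝ} (hc : c ≠ 0)
    (hg : (g' : Matrix (Fin 2) (Fin 2) ℝ) = c • (toReal γ * (g : Matrix (Fin 2) (Fin 2) ℝ)))
    {n : ℕ} (hn : ∀ w ∈ Submodule.map (Ad g) cartan, w ≠ 0 →
        (n : ℝ) • ((form w w)⁻¹ • (w ⊗ₜ[ℝ] w)) ∈ tensorLatticeZ) :
    ∃ k : ℤ, n * (f ((g' : Matrix (Fin 2) (Fin 2) ℝ) * !![1, 0; 0, -1] *
      ((g'⁻¹ : GL (Fin 2) ℝ) : Matrix (Fin 2) (Fin 2) ℝ)) / 2) ^ 2 = k := by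
  set γ' : GL (Fin 2) ℝ := GeneralLinearGroup.map (Int.castRingHom ℝ) γ
  have hγ' : (γ' : Matrix (Fin 2) (Fin 2) ℝ) = toReal γ := rfl
  have hγi : ((γ'⁻¹ : GL (Fin 2) ℝ) : Matrix (Fin 2) (Fin 2) ℝ) =
      toReal ((γ⁻¹ : GL (Fin 2) ℤ) : Matrix (Fin 2) (Fin 2) ℤ) := by
    rw [← map_inv]; rfl
  set E : Matrix (Fin 2) (Fin 2) ℝ := !![1, 0; 0, -1]
  set w := scalars.mkQ ((g : Matrix (Fin 2) (Fin 2) ℝ) * E *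
      ((g⁻¹ : GL (Fin 2) ℝ) : Matrix (Fin 2) (Fin 2) ℝ)) with hw
  have hww : form w w = 4 := by
    have h1 : ((g : Matrix (Fin 2) (Fin 2) ℝ) * E *
      ((g⁻¹ : GL (Fin 2) ℝ) : Matrix (Fin 2) (Fin 2) ℝ)).trace = 0 := by
      rw [trace_mul_comm, ← mul_assoc, ← Units.val_mul, inv_mul_cancel, Units.val_one, one_mul]
      simp [E]
    have h2 : ((g : Matrix (Fin 2) (Fin 2) ℝ) * E *
      ((g⁻¹ : GL (Fin 2) ℝ) : Matrix (Fin 2) (Fin 2) ℝ)).det = -1 := by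
      rw [det_mul_comm, ← mul_assoc, ← Units.val_mul, inv_mul_cancel, Units.val_one, one_mul]
      simp [E]
    rw [hw, form_self_mkQ, h1, h2]
    norm_num
  have hw0 : w ≠ 0 := by
    intro h0
    rw [h0] at hww
    simp at hww
  set ψ : LieAlg →ₗ[ℝ] ℝ := coordinate f hf ∘ₗ Ad γ'
  have hψ : ∀ v ∈ latticeZ, ∃ k : ℤ, ψ v = k := by
    rintro _ ⟨M, rfl⟩
    obtain ⟨k, hk⟩ := hfZ ((γ : Matrix (Fin 2) (Fin 2) ℤ) * M *
      ((γ⁻¹ : GL (Fin 2) ℤ) : Matrix (Fin 2) (Fin 2) ℤ))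
    refine ⟨k, ?_⟩
    rw [← hk, toReal_mul, toReal_mul, ← hγ', ← hγi, LinearMap.comp_apply, Ad_mkQ]
    rfl
  obtain ⟨k, hk⟩ := exists_int_of_mem_tensorLatticeZ hψ
    (hn w (mem_map_Ad_cartan_of_diag g 1 (-1)) hw0)
  refine ⟨k, ?_⟩
  have hψw : ψ w = f ((g' : Matrix (Fin 2) (Fin 2) ℝ) * E *
      ((g'⁻¹ : GL (Fin 2) ℝ) : Matrix (Fin 2) (Fin 2) ℝ)) := by
    have hgi : ((g'⁻¹ : GL (Fin 2) ℝ) : Matrix (Fin 2) (Fin 2) ℝ) =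
        c⁻¹ • (((g⁻¹ : GL (Fin 2) ℝ) : Matrix (Fin 2) (Fin 2) ℝ) *
          ((γ'⁻¹ : GL (Fin 2) ℝ) : Matrix (Fin 2) (Fin 2) ℝ)) := by
      rw [← Units.inv_eq_val_inv]
      refine Units.inv_eq_of_mul_eq_one_right ?_
      rw [hg, ← hγ', smul_mul_smul_comm, mul_inv_cancel₀ hc, one_smul, ← Units.val_mul,
        ← Units.val_mul, ← Units.val_mul]
      simp
    rw [LinearMap.comp_apply, hw, Ad_mkQ, hg, hgi, hγ', smul_mul_assoc, smul_mul_smul_comm,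
      mul_inv_cancel₀ hc, one_smul]
    simp only [mul_assoc]
    rfl
  rw [map_smul, map_smul, map_smul, map_smul, TensorProduct.map_tmul, LinearMap.mul'_apply, hww,
    hψw] at hk
  rw [← hk, smul_eq_mul, smul_eq_mul]
  ring

theorem finite_periodicOrbitsIn {δ : ℝ} (hδ : 0 < δ) (D : ℝ) : (periodicOrbitsIn δ D).Finite := by
  set B := 4 / (3 * δ)
  set F := {z : ℝ | |z| ≤ 2 * B ∧ ∃ n : ℕ, 0 < n ∧ (n : ℝ) ≤ D ∧ ∃ k : ℤ, n * z ^ 2 = k}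
  have hF : F.Finite := finite_bounded_sq D (2 * B)
  set 𝓞 : ℝ × ℝ × ℝ → Set (Set X) := fun v => {Y | ∃ g : SL(2, ℝ),
    Y = orbit (coset (ProjGenLinGroup.mk (SpecialLinearGroup.toGL g))) ∧
    g 0 0 * g 0 1 = v.1 ∧ g 1 0 * g 1 1 = v.2.1 ∧ g 0 0 * g 1 1 + g 0 1 * g 1 0 = v.2.2}
  have h𝓞 : ∀ v, (𝓞 v).Finite := fun v => by
    refine Set.Subsingleton.finite ?_
    rintro _ ⟨g, rfl, h1, h2, h3⟩ _ ⟨g', rfl, h1', h2', h3'⟩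
    exact orbit_eq_of_products_eq (h1.trans h1'.symm) (h2.trans h2'.symm) (h3.trans h3'.symm)
  refine ((hF.prod (hF.prod hF)).biUnion fun v _ => h𝓞 v).subset ?_
  rintro Y ⟨hY, hYΩ, hYD⟩
  have hne : {n : ℕ | ∃ g : GL (Fin 2) ℝ, coset (ProjGenLinGroup.mk g) ∈ Y ∧
      n = cartanDisc (Submodule.map (Ad g) cartan)}.Nonempty := by
    obtain ⟨y, hy⟩ := hY.nonempty
    obtain ⟨g, rfl⟩ := exists_coset_mk y
    exact ⟨_, g, hy, rfl⟩
  obtain ⟨g, hgY, hgd⟩ : ∃ g : GL (Fin 2) ℝ, coset (ProjGenLinGroup.mk g) ∈ Y ∧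
      disc Y = cartanDisc (Submodule.map (Ad g) cartan) := Nat.sInf_mem hne
  obtain ⟨T, hT, hTY⟩ := hY.exists_period
  obtain ⟨hpos, hint⟩ := cartanDisc_spec hT (hTY _ hgY)
  rw [← hgd] at hpos hint
  obtain ⟨g', hg', hB⟩ := exists_reduced hδ (hYΩ hgY)
  obtain ⟨γ, c, hc, e⟩ := coset_eq_iff.1 hg'
  have hinv : (((SpecialLinearGroup.toGL g')⁻¹ : GL (Fin 2) ℝ) : Matrix (Fin 2) (Fin 2) ℝ) =
      !![g' 1 1, -g' 0 1; -g' 1 0, g' 0 0] := by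
    rw [← map_inv]
    exact (Matrix.SpecialLinearGroup.coe_inv g').trans (adjugate_fin_two _)
  have hconj : ((SpecialLinearGroup.toGL g' : GL (Fin 2) ℝ) : Matrix (Fin 2) (Fin 2) ℝ) *
      !![1, 0; 0, -1] *
      (((SpecialLinearGroup.toGL g')⁻¹ : GL (Fin 2) ℝ) : Matrix (Fin 2) (Fin 2) ℝ) =
      !![g' 0 0 * g' 1 1 + g' 0 1 * g' 1 0, -(2 * (g' 0 0 * g' 0 1));
        2 * (g' 1 0 * g' 1 1), -(g' 0 0 * g' 1 1 + g' 0 1 * g' 1 0)] := by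
    rw [hinv]
    change (g' : Matrix (Fin 2) (Fin 2) ℝ) * _ * _ = _
    ext i j
    fin_cases i <;> fin_cases j <;> simp [mul_apply, Fin.sum_univ_two] <;> ring
  have hbd : ∀ i j k l, |g' i j * g' k l| ≤ B := by
    intro i j k l
    rw [abs_le]
    have h1 := hB i j
    have h2 := hB k l
    constructor <;> nlinarith [sq_nonneg (g' i j + g' k l), sq_nonneg (g' i j - g' k l)]
  have hB0 : 0 ≤ B := (abs_nonneg _).trans (hbd 0 0 0 0)
  have key := fun (f : Matrix (Fin 2) (Fin 2) ℝ →ₗ[ℝ] ℝ) (hf : f 1 = 0) hfZ =>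
    exists_int_of_coordinate hf hfZ hc e hint
  rw [hconj] at key
  -- These three functionals vanish on scalars; half their values are, up to sign, the products that
  -- determine the orbit.
  obtain ⟨k₁, hk₁⟩ := key (entryLinearMap ℝ ℝ 0 1) (by simp) fun M => ⟨M 0 1, by simp⟩
  obtain ⟨k₂, hk₂⟩ := key (entryLinearMap ℝ ℝ 1 0) (by simp) fun M => ⟨M 1 0, by simp⟩
  obtain ⟨k₃, hk₃⟩ := key (entryLinearMap ℝ ℝ 0 0 - entryLinearMap ℝ ℝ 1 1) (by simp)
    fun M => ⟨M 0 0 - M 1 1, by simp⟩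
  simp at hk₁ hk₂ hk₃
  have hmem : ∀ z : ℝ, |z| ≤ 2 * B → (∃ k : ℤ, (disc Y : ℝ) * z ^ 2 = k) → z ∈ F :=
    fun z hz hk => ⟨hz, disc Y, hpos, hYD, hk⟩
  refine Set.mem_biUnion (x := (g' 0 0 * g' 0 1, g' 1 0 * g' 1 1,
    g' 0 0 * g' 1 1 + g' 0 1 * g' 1 0)) ⟨hmem _ ?_ ⟨k₁, ?_⟩, hmem _ ?_ ⟨k₂, ?_⟩,
      hmem _ ?_ ⟨k₃, ?_⟩⟩ ⟨g', ?_, rfl, rfl, rfl⟩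
  · exact (hbd _ _ _ _).trans (by linarith)
  · linear_combination hk₁
  · exact (hbd _ _ _ _).trans (by linarith)
  · linear_combination hk₂
  · exact (abs_add_le _ _).trans (by linarith [hbd 0 0 1 1, hbd 0 1 1 0])
  · linear_combination hk₃
  · rw [← hg']
    exact hY.eq_orbit hgY

/-! ### The periodic orbit of a word -/

/-- The attracting and repelling fixed points of the matrix of a word. -/
theorem exists_fixed_points {N : ℕ} {w : List ℕ} (hw : IsBoundedWord N w) (hne : w ≠ []) :
    ∃ α β : ℝ, 1 < α ∧ -1 < β ∧ β < 0 ∧ wordMobius w α = α ∧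
      (wordMatrix w 1 0 : ℝ) * (α + β) = wordMatrix w 0 0 - wordMatrix w 1 1 ∧
      (wordMatrix w 1 0 : ℝ) * (α * β) = -wordMatrix w 0 1 := by
  obtain ⟨hp1, -, -, hs0, hqp, hrp, -, -⟩ := wordMatrix_entries hw
  obtain ⟨hq1, hr1, hsq, hsr, -⟩ := wordMatrix_entries_of_ne_nil hw hne
  have hdet := wordMatrix_det w
  rw [det_fin_two] at hdet
  -- Determinant ±1 forbids equal rows or columns. The resulting strict inequalities give the signs
  -- of r x² - (p - s) x - q at 1 and -1, which locate the roots.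
  have hstrict : ¬(wordMatrix w 1 0 = wordMatrix w 0 0 ∧ wordMatrix w 1 1 = wordMatrix w 0 1) := by
    rintro ⟨h1, h2⟩
    rw [h1, h2, mul_comm, sub_self] at hdet
    lia
  have hstrict' : ¬(wordMatrix w 0 1 = wordMatrix w 0 0 ∧ wordMatrix w 1 1 = wordMatrix w 1 0) := by
    rintro ⟨h1, h2⟩
    rw [h1, h2, sub_self] at hdet
    lia
  have f1 : wordMatrix w 1 0 + wordMatrix w 1 1 < wordMatrix w 0 0 + wordMatrix w 0 1 := by lia
  have f2 : wordMatrix w 1 1 + wordMatrix w 0 1 < wordMatrix w 0 0 + wordMatrix w 1 0 := by lia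
  have f1' : (wordMatrix w 1 0 : ℝ) + wordMatrix w 1 1 < wordMatrix w 0 0 + wordMatrix w 0 1 := by
    exact_mod_cast f1
  have f2' : (wordMatrix w 1 1 : ℝ) + wordMatrix w 0 1 < wordMatrix w 0 0 + wordMatrix w 1 0 := by
    exact_mod_cast f2
  have hq : (1 : ℝ) ≤ wordMatrix w 0 1 := by exact_mod_cast hq1
  have hr : (1 : ℝ) ≤ wordMatrix w 1 0 := by exact_mod_cast hr1
  have hs : (0 : ℝ) ≤ wordMatrix w 1 1 := by exact_mod_cast hs0
  have hspec := fun x => wordMobius_spec hw (x := x)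
  generalize (wordMatrix w 0 0 : ℝ) = p at *
  generalize (wordMatrix w 0 1 : ℝ) = q at *
  generalize (wordMatrix w 1 0 : ℝ) = r at *
  generalize (wordMatrix w 1 1 : ℝ) = s at *
  have hD : 0 ≤ (p - s) ^ 2 + 4 * q * r := by positivity
  set e := √((p - s) ^ 2 + 4 * q * r)
  have he : e ^ 2 = (p - s) ^ 2 + 4 * q * r := Real.sq_sqrt hD
  have he0 : 0 ≤ e := Real.sqrt_nonneg _
  have hr0 : 0 < r := by linarith
  have hα : 1 < (p - s + e) / (2 * r) := by
    rw [one_lt_div (by positivity)]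
    by_contra! h
    nlinarith [mul_pos hr0 (sub_pos.2 f1')]
  have hβ : -1 < (p - s - e) / (2 * r) := by
    rw [lt_div_iff₀ (by positivity)]
    by_contra! h
    nlinarith [mul_pos hr0 (sub_pos.2 f2')]
  have hβ0 : (p - s - e) / (2 * r) < 0 := by
    refine div_neg_of_neg_of_pos ?_ (by positivity)
    by_contra! h
    nlinarith [mul_pos hr0 (zero_lt_one.trans_le hq)]
  refine ⟨_, _, hα, hβ, hβ0, ?_, ?_, ?_⟩
  · have h1 := hspec _ hα
    set α := (p - s + e) / (2 * r) with hαdef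
    have h2 : 2 * r * α = p - s + e := by rw [hαdef]; field_simp
    have h3 : p * α + q = α * (r * α + s) := by
      have : 4 * r * (p * α + q - α * (r * α + s)) = 0 := by
        linear_combination (-(2 * r * α - (p - s) + e)) * h2 - he
      rcases mul_eq_zero.1 this with h | h <;> linarith
    have hpos : 0 < r * α + s := by positivity
    exact (mul_right_cancel₀ hpos.ne' (h3.symm.trans h1)).symm
  · field_simp
    ring
  · field_simp
    linear_combination -he

/-- The matrix of the word is diagonalised by g, which gives a period and bounds the discriminant by
tr² - 4 det ≤ 5 tr². The lower bound for its form gives the containment in Ω'_δ. -/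
theorem orbit_word {N : ℕ} {w : List ℕ} (hw : IsBoundedWord N w) (hne : w ≠ []) :
    ∃ (α β : ℝ) (g : GL (Fin 2) ℝ), (g : Matrix (Fin 2) (Fin 2) ℝ) = !![α, β; 1, 1] ∧
      1 < α ∧ α < N + 1 ∧ -1 < β ∧ β < 0 ∧ wordMobius w α = α ∧
      IsPeriodicOrbit (orbit (coset (ProjGenLinGroup.mk g))) ∧
      orbit (coset (ProjGenLinGroup.mk g)) ⊆ Omega (1 / (6 * (N + 1) ^ 2)) ∧
      (disc (orbit (coset (ProjGenLinGroup.mk g))) : ℤ) ≤ 5 * (wordMatrix w).trace ^ 2 := by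
  obtain ⟨α, β, hα, hβ, hβ0, hfix, hsum, hprod⟩ := exists_fixed_points hw hne
  have hαN : α < N + 1 := hfix ▸ wordMobius_lt hw hne hα
  have hαβ : 0 < α - β := by linarith
  set g : GL (Fin 2) ℝ := GeneralLinearGroup.mkOfDetNeZero !![α, β; 1, 1]
    (by rw [det_fin_two_of]; linarith)
  have hg : (g : Matrix (Fin 2) (Fin 2) ℝ) = !![α, β; 1, 1] := rfl
  have hgdet : (g : Matrix (Fin 2) (Fin 2) ℝ).det = α - β := by rw [hg, det_fin_two_of]; ring
  obtain ⟨-, hr1, -, -, -⟩ := wordMatrix_entries_of_ne_nil hw hne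
  have hform := fun x y => trace_le_matrixForm hw hne (x := x) (y := y)
  have ht := wordMatrix_trace_pos hw
  have hdet := wordMatrix_det w
  set M := wordMatrix w
  have hr : (1 : ℝ) ≤ M 1 0 := by exact_mod_cast hr1
  have ht1 : (1 : ℝ) ≤ M.trace := by exact_mod_cast ht
  have htr : ((M.trace : ℤ) : ℝ) = M 0 0 + M 1 1 := by rw [trace_fin_two]; push_cast; rfl
  have hdt : ((M.det : ℤ) : ℝ) = M 0 0 * M 1 1 - M 0 1 * M 1 0 := by
    rw [det_fin_two]; push_cast; rfl
  set l₁ : ℝ := M 1 0 * α + M 1 1 with hl₁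
  set l₂ : ℝ := M 1 0 * β + M 1 1 with hl₂
  have hMg : toReal M * (g : Matrix (Fin 2) (Fin 2) ℝ) =
      (g : Matrix (Fin 2) (Fin 2) ℝ) * !![l₁, 0; 0, l₂] := by
    rw [hg]
    ext i j
    fin_cases i <;> fin_cases j <;> simp [mul_apply, Fin.sum_univ_two]
    · rw [hl₁]; linear_combination (-α) * hsum + hprod
    · rw [hl₂]; linear_combination (-β) * hsum + hprod
    · exact hl₁.symm
    · exact hl₂.symm
  have hM : toReal M = (g : Matrix (Fin 2) (Fin 2) ℝ) * !![l₁, 0; 0, l₂] *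
      ((g⁻¹ : GL (Fin 2) ℝ) : Matrix (Fin 2) (Fin 2) ℝ) := by
    rw [← hMg, mul_assoc, ← Units.val_mul, mul_inv_cancel, Units.val_one, mul_one]
  have hlsub : l₁ - l₂ = M 1 0 * (α - β) := by rw [hl₁, hl₂]; ring
  have hladd : l₁ + l₂ = M.trace := by rw [htr, hl₁, hl₂]; linear_combination hsum
  have hlmul : l₁ * l₂ = M.det := by
    rw [hdt, hl₁, hl₂]; linear_combination (M 1 1 : ℝ) * hsum + (M 1 0 : ℝ) * hprod
  have hlpos : 0 < l₁ - l₂ := by rw [hlsub]; positivity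
  have hdisc : ((matrixDisc M : ℤ) : ℝ) = (l₁ - l₂) ^ 2 := by
    rw [matrixDisc, Int.cast_sub, Int.cast_pow, Int.cast_mul, Int.cast_ofNat, ← hladd, ← hlmul]
    ring
  have hdiscpos : 0 < matrixDisc M := by
    have : (0 : ℝ) < (matrixDisc M : ℤ) := by rw [hdisc]; positivity
    exact_mod_cast this
  have hdiscle : matrixDisc M ≤ 5 * M.trace ^ 2 := by
    rw [matrixDisc]
    rcases hdet with h | h <;> rw [h] <;> nlinarith
  refine ⟨α, β, g, hg, hα, hαN, hβ, hβ0, hfix, ⟨_, rfl, ?_⟩, ?_, ?_⟩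
  · have hd2 : (l₁ * l₂) ^ 2 = 1 := by rcases hdet with h | h <;> rw [hlmul, h] <;> norm_num
    have hl1 : 1 < l₁ := by
      by_contra! h
      have h0 : 0 < l₁ := by linarith
      have h3 : l₂ ^ 2 < 1 := by nlinarith
      nlinarith [mul_pow l₁ l₂ 2, sq_nonneg l₂, mul_le_mul h h h0.le zero_le_one]
    have hlog := Real.log_pos hl1
    have hE : Real.exp (4 * Real.log l₁ / 2) = l₁ ^ 2 := by
      rw [show 4 * Real.log l₁ / 2 = (2 : ℕ) * Real.log l₁ by push_cast; ring, Real.exp_nat_mul,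
        Real.exp_log (by linarith)]
    have hE' : Real.exp (-(4 * Real.log l₁) / 2) = l₂ ^ 2 := by
      rw [neg_div, Real.exp_neg, hE]
      refine inv_eq_of_mul_eq_one_right ?_
      rw [← mul_pow, hd2]
    -- M may have determinant -1, so M² is used: its eigenvalues are l₁² and l₂² = l₁⁻².
    refine ⟨4 * Real.log l₁, by positivity, ?_⟩
    have hu : IsUnit M.det := by rcases hdet with h | h <;> simp [h]
    rw [flow_coset]
    refine (coset_eq_iff.2 ⟨GeneralLinearGroup.mk'' M hu * GeneralLinearGroup.mk'' M hu, 1,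
      one_ne_zero, ?_⟩).symm
    have h1 : ((GeneralLinearGroup.mk'' M hu : GL (Fin 2) ℤ) : Matrix (Fin 2) (Fin 2) ℤ) = M := rfl
    rw [one_smul, Units.val_mul, Units.val_mul, h1, toReal_mul, mul_assoc, hMg, ← mul_assoc, hMg,
      mul_assoc, coe_geodesicMatrix, hE, hE']
    congr 1
    ext i j
    fin_cases i <;> fin_cases j <;> simp [mul_apply, Fin.sum_univ_two, sq]
  · refine orbit_subset_Omega fun m hm => ?_
    have hm' : m 0 ≠ 0 ∨ m 1 ≠ 0 := by
      by_contra! h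
      exact hm (by ext i; fin_cases i <;> simp [h])
    have hf := hform (m 0) (m 1) hm'
    have hf' : (M.trace : ℝ) ≤ 2 * (N + 1) ^ 2 * |(matrixForm M (m 0) (m 1) : ℝ)| := by
      exact_mod_cast hf
    have huv : (M 1 0 : ℝ) * (((fun i => (m i : ℝ)) ᵥ* (g : Matrix (Fin 2) (Fin 2) ℝ)) 0 *
        ((fun i => (m i : ℝ)) ᵥ* (g : Matrix (Fin 2) (Fin 2) ℝ)) 1) =
        -(matrixForm M (m 0) (m 1) : ℝ) := by
      rw [hg, matrixForm]
      simp only [vecMul, dotProduct, Fin.sum_univ_two, of_apply, cons_val', cons_val_zero,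
        cons_val_one, cons_val_fin_one]
      push_cast
      linear_combination (m 0 : ℝ) ^ 2 * hprod + (m 0 : ℝ) * (m 1) * hsum
    have habs := congrArg abs huv
    rw [abs_mul, abs_neg, abs_of_pos (show (0 : ℝ) < M 1 0 by linarith)] at habs
    rw [hgdet, abs_of_pos hαβ, div_mul_eq_mul_div, one_mul, div_le_iff₀ (by positivity)]
    refine le_of_mul_le_mul_left ?_ (show (0 : ℝ) < M 1 0 by linarith)
    -- Since √5 < 3; multiplied by the constant 2(N+1)² of the form bound this gives the 6(N+1)² in
    -- δ.
    have h3 : l₁ - l₂ ≤ 3 * M.trace := by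
      have h5 : ((matrixDisc M : ℤ) : ℝ) ≤ 5 * (M.trace : ℝ) ^ 2 := by exact_mod_cast hdiscle
      rw [hdisc] at h5
      refine abs_le_of_sq_le_sq' ?_ (by positivity) |>.2
      nlinarith
    calc (M 1 0 : ℝ) * (α - β) = l₁ - l₂ := hlsub.symm
      _ ≤ 3 * M.trace := h3
      _ ≤ 3 * (2 * (N + 1) ^ 2 * |(matrixForm M (m 0) (m 1) : ℝ)|) := by linarith
      _ = _ := by rw [← habs]; ring
  · exact (disc_le (sub_ne_zero.1 hlpos.ne') hM hdiscpos).trans hdiscle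

/-! ### Multiplicities -/

/-- Integral matrices relating nearby points of the orbits of words are bounded. -/
theorem abs_apply_le_of_flow {N : ℕ} {α β α' β' u c : ℝ} {γ : Matrix (Fin 2) (Fin 2) ℤ}
    (hα : 1 < α) (hαN : α < N + 1) (hβ : -1 < β) (hβ0 : β < 0)
    (hα' : 1 < α') (hαN' : α' < N + 1) (hβ' : -1 < β') (hβ0' : β' < 0) (hu : |u| ≤ 1)
    (hγ : γ.det = 1 ∨ γ.det = -1)
    (h : !![α', β'; 1, 1] = c • (toReal γ * (!![α, β; 1, 1] *
      !![Real.exp (u / 2), 0; 0, Real.exp (-u / 2)]))) (i j : Fin 2) :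
    |(γ i j : ℝ)| ≤ (N + 2) * (2 * ((N + 1) * (2 * (2 * (N + 1))))) := by
  have hN : (0 : ℝ) ≤ N := by positivity
  have hprod : Real.exp (u / 2) * Real.exp (-u / 2) = 1 := by
    rw [← Real.exp_add]; simp; ring
  have hd := congrArg Matrix.det h
  have hγ2 : |(γ.det : ℝ)| = 1 := by rcases hγ with h | h <;> simp [h]
  rw [det_smul, det_mul, det_mul, toReal_det, det_fin_two_of, det_fin_two_of, det_fin_two_of,
    hprod, Fintype.card_fin] at hd
  have hc : α' - β' = c ^ 2 * (α - β) := by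
    have := congrArg abs hd
    rw [abs_mul, abs_mul, abs_mul, hγ2, abs_of_pos (by linarith), abs_of_nonneg (sq_nonneg c),
      abs_of_pos (show 0 < α * 1 - β * 1 by linarith)] at this
    simp at this
    linarith
  have hc0 : c ≠ 0 := by rintro rfl; simp at hc; linarith
  -- Determinants give c² = (α' - β')/(α - β), whose numerator exceeds 1 and whose denominator is
  -- below N + 2.
  have hcinv : |c⁻¹| ≤ N + 2 := by
    rw [abs_inv]
    have h1 : 1 ≤ c ^ 2 * (N + 2) := by
      calc 1 ≤ c ^ 2 * (α - β) := by linarith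
        _ ≤ _ := by gcongr; linarith
    have hcpos : 0 < |c| := abs_pos.2 hc0
    rw [inv_le_comm₀ hcpos (by positivity)]
    by_contra! hlt
    have h2 : |c| * (N + 2) < 1 := by
      rwa [← one_div, lt_div_iff₀ (by positivity)] at hlt
    rw [← sq_abs] at h1
    nlinarith
  have hexp : ∀ v : ℝ, |v| ≤ 1 → |Real.exp (v / 2)| ≤ 2 := by
    intro v hv
    rw [Real.abs_exp]
    have h1 : Real.exp (v / 2) ^ 2 < 2.7182818286 := by
      rw [← Real.exp_nat_mul]
      refine lt_of_le_of_lt (Real.exp_le_exp.2 ?_) Real.exp_one_lt_d9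
      have := (abs_le.1 hv).2
      push_cast; linarith
    nlinarith [Real.exp_pos (v / 2)]
  set A : Matrix (Fin 2) (Fin 2) ℝ :=
    (α - β)⁻¹ • !![1, -β; -1, α]
  set H : Matrix (Fin 2) (Fin 2) ℝ := !![Real.exp (-u / 2), 0; 0, Real.exp (u / 2)]
  have hA : ∀ i j, |A i j| ≤ N + 1 := by
    have hinv : |(α - β)⁻¹| ≤ 1 := by
      rw [abs_of_pos (by positivity [show 0 < α - β by linarith])]
      exact inv_le_one_of_one_le₀ (by linarith)
    intro i j
    have : |!![1, -β; -1, α] i j| ≤ N + 1 := by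
      rw [abs_le]
      fin_cases i <;> fin_cases j <;> simp <;> (try constructor) <;> linarith
    calc |A i j| = |(α - β)⁻¹| * |!![1, -β; -1, α] i j| := abs_mul _ _
      _ ≤ 1 * (N + 1) := by gcongr
      _ = N + 1 := one_mul _
  have hH : ∀ i j, |H i j| ≤ 2 := by
    intro i j
    have h1 := hexp u hu
    have h2 := hexp (-u) (by rwa [abs_neg])
    rw [Real.abs_exp] at h1 h2
    fin_cases i <;> fin_cases j <;> simp [H] <;> assumption
  have hG : ∀ i j, |(!![α', β'; 1, 1] : Matrix (Fin 2) (Fin 2) ℝ) i j| ≤ N + 1 := by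
    intro i j
    rw [abs_le]
    fin_cases i <;> fin_cases j <;> simp <;> (try constructor) <;> linarith
  have key : toReal γ = c⁻¹ • (!![α', β'; 1, 1] * (H * A)) := by
    have hinv : (!![α, β; 1, 1] * !![Real.exp (u / 2), 0; 0, Real.exp (-u / 2)]) * (H * A) = 1 := by
      have hab : α - β ≠ 0 := by linarith
      have h1 : !![Real.exp (u / 2), 0; 0, Real.exp (-u / 2)] * H = 1 := by
        ext i j
        fin_cases i <;> fin_cases j <;> simp [H, mul_apply, Fin.sum_univ_two, hprod]
        rw [mul_comm, hprod]
      rw [mul_assoc, ← mul_assoc _ H, h1, one_mul]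
      ext i j
      fin_cases i <;> fin_cases j <;> simp [A, mul_apply, Fin.sum_univ_two] <;> field_simp <;> ring
    rw [h, smul_mul_assoc, smul_smul, inv_mul_cancel₀ hc0, one_smul, mul_assoc, hinv, mul_one]
  have e : (γ i j : ℝ) = toReal γ i j := rfl
  rw [e, key, Matrix.smul_apply, smul_eq_mul, abs_mul]
  exact mul_le_mul hcinv (abs_mul_apply_le hG (abs_mul_apply_le hH hA) i j) (abs_nonneg _)
    (by positivity)

/-- The number of words of a separated family that give rise to a given periodic orbit. -/
theorem exists_card_le_length (N : ℕ) : ∃ K : ℝ, 0 < K ∧ ∀ (S : Finset (List ℕ))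
    (α β : List ℕ → ℝ) (g : List ℕ → GL (Fin 2) ℝ), IsSeparated S →
    (∀ w ∈ S, (g w : Matrix (Fin 2) (Fin 2) ℝ) = !![α w, β w; 1, 1] ∧ 1 < α w ∧ α w < N + 1 ∧
      -1 < β w ∧ β w < 0 ∧ wordMobius w (α w) = α w) →
    ∀ Y : Set X, IsPeriodicOrbit Y → ∀ S' ⊆ S,
      (∀ w ∈ S', orbit (coset (ProjGenLinGroup.mk (g w))) = Y) → (S'.card : ℝ) ≤ K * length Y := by
  set B : ℝ := (N + 2) * (2 * ((N + 1) * (2 * (2 * (N + 1)))))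
  set F := (finite_integral_matrices B).toFinset
  -- The factor 3 comes from ⌊T⌋ + 1 ≤ length Y + 2 ≤ 3 length Y.
  refine ⟨3 * (F.card + 1), by positivity, fun S α β g hS hg Y hY S' hS' hSY => ?_⟩
  obtain ⟨T, hT, hTl, hTY⟩ := hY.exists_period_lt
  obtain ⟨y, hy⟩ := hY.nonempty
  have htime : ∀ w, ∃ s : ℝ, w ∈ S' → s ∈ Set.Ico 0 T ∧
      flow s y = coset (ProjGenLinGroup.mk (g w)) := by
    intro w
    by_cases hw : w ∈ S'
    · obtain ⟨s, hs, h⟩ := exists_mem_Ico_flow_eq hT (hTY y hy)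
        (y := coset (ProjGenLinGroup.mk (g w))) (by
          rw [← hY.eq_orbit hy, ← hSY w hw]; exact mem_orbit_self _)
      exact ⟨s, fun _ => ⟨hs, h⟩⟩
    · exact ⟨0, fun h => absurd h hw⟩
  choose s hs using htime
  have hmaps : ∀ w ∈ S', ⌊s w⌋₊ ∈ Finset.range (⌊T⌋₊ + 1) := fun w hw =>
    Finset.mem_range.2 (Nat.lt_succ_of_le (Nat.floor_le_floor (hs w hw).1.2.le))
  -- Words reached in the same unit of time are compared with one fixed word w₀ among them, through
  -- integral matrices taken from the finite set F.
  have hfib : ∀ j ∈ Finset.range (⌊T⌋₊ + 1), (S'.filter fun w => ⌊s w⌋₊ = j).card ≤ F.card := by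
    intro j _
    rcases (S'.filter fun w => ⌊s w⌋₊ = j).eq_empty_or_nonempty with h0 | ⟨w₀, hw₀⟩
    · simp [h0]
    obtain ⟨hw₀S, hj₀⟩ := Finset.mem_filter.1 hw₀
    obtain ⟨hg₀, a1, a2, a3, a4, -⟩ := hg w₀ (hS' hw₀S)
    have hγ : ∀ w, ∃ γ : GL (Fin 2) ℤ, w ∈ S'.filter (fun w => ⌊s w⌋₊ = j) →
        ∃ c u : ℝ, |u| ≤ 1 ∧ !![α w, β w; 1, 1] = c • (toReal γ * (!![α w₀, β w₀; 1, 1] *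
          !![Real.exp (u / 2), 0; 0, Real.exp (-u / 2)])) := by
      intro w
      by_cases hw : w ∈ S'.filter (fun w => ⌊s w⌋₊ = j)
      · obtain ⟨hwS, hj⟩ := Finset.mem_filter.1 hw
        have hflow : flow (s w - s w₀) (coset (ProjGenLinGroup.mk (g w₀))) =
            coset (ProjGenLinGroup.mk (g w)) := by
          rw [← (hs w₀ hw₀S).2, ← flow_add, add_sub_cancel, (hs w hwS).2]
        rw [flow_coset] at hflow
        obtain ⟨γ, c, -, e⟩ := coset_eq_iff.1 hflow
        refine ⟨γ, fun _ => ⟨c, s w - s w₀, ?_, ?_⟩⟩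
        · have b1 := Nat.floor_le (hs w hwS).1.1
          have b2 := Nat.lt_floor_add_one (s w)
          have b3 := Nat.floor_le (hs w₀ hw₀S).1.1
          have b4 := Nat.lt_floor_add_one (s w₀)
          rw [hj] at b1 b2
          rw [hj₀] at b3 b4
          rw [abs_le]
          constructor <;> linarith
        · rw [← (hg w (hS' hwS)).1, e, Units.val_mul, hg₀, coe_geodesicMatrix]
      · exact ⟨1, fun h => absurd h hw⟩
    choose γ hγ using hγ
    refine Finset.card_le_card_of_injOn (fun w => (γ w : Matrix (Fin 2) (Fin 2) ℤ)) ?_ ?_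
    · intro w hw
      obtain ⟨c, u, hu, e⟩ := hγ w hw
      obtain ⟨-, b1, b2, b3, b4, -⟩ := hg w (hS' (Finset.mem_filter.1 hw).1)
      have hdet := Int.isUnit_iff.1 ((Matrix.isUnit_iff_isUnit_det _).1 (γ w).isUnit)
      exact (Set.Finite.mem_toFinset _).2
        fun i j => abs_apply_le_of_flow a1 a2 a3 a4 b1 b2 b3 b4 hu hdet e i j
    · intro v hv w hw hvw
      simp only at hvw
      -- The first column of the matrix identity says α w = γ · α w₀, so γ determines α w;
      -- separation then recovers w, since α w is a fixed point of w.
      have hcol : ∀ w ∈ S'.filter (fun w => ⌊s w⌋₊ = j),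
          α w = (toReal (γ w) 0 0 * α w₀ + toReal (γ w) 0 1) /
            (toReal (γ w) 1 0 * α w₀ + toReal (γ w) 1 1) := by
        intro w hw
        obtain ⟨c, u, -, e⟩ := hγ w hw
        have e0 := congrFun (congrFun e 0) 0
        have e1 := congrFun (congrFun e 1) 0
        simp [mul_apply, Fin.sum_univ_two] at e0 e1
        have hne : toReal (γ w) 1 0 * α w₀ + toReal (γ w) 1 1 ≠ 0 := by
          intro h0
          simp at h0
          have : (1 : ℝ) = 0 := by linear_combination e1 + c * Real.exp (u / 2) * h0
          exact one_ne_zero this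
        rw [eq_div_iff hne]
        simp
        linear_combination
          (γ w 1 0 * α w₀ + γ w 1 1) * e0 - (γ w 0 0 * α w₀ + γ w 0 1) * e1
      have hα : α v = α w := by rw [hcol v hv, hcol w hw, hvw]
      have hvS := hS' (Finset.mem_filter.1 hv).1
      have hwS := hS' (Finset.mem_filter.1 hw).1
      obtain ⟨-, v1, -, -, -, v5⟩ := hg v hvS
      obtain ⟨-, w1, -, -, -, w5⟩ := hg w hwS
      exact hS v hvS w hwS _ _ v1 w1 (by rw [v5, w5, hα])
  have hcard := Finset.card_le_mul_card_image_of_maps_to hmaps F.card hfib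
  rw [Finset.card_range] at hcard
  have hcard' : (S'.card : ℝ) ≤ F.card * (⌊T⌋₊ + 1) := by exact_mod_cast hcard
  have hl := hY.one_le_length
  have hfl := Nat.floor_le hT.le
  calc (S'.card : ℝ) ≤ F.card * (⌊T⌋₊ + 1) := hcard'
    _ ≤ (F.card + 1) * (3 * length Y) := by gcongr <;> linarith
    _ = 3 * (F.card + 1) * length Y := by ring

end PGL2Geodesic

end

/-! ### Choice of parameters and the final count -/

open PGL2Geodesic in
theorem theorem1p5 (ε : ℝ) (hε : 0 < ε) :
    ∃ δ : ℝ, 0 < δ ∧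
      IsCompact (PGL2Geodesic.Omega δ) ∧
      (∀ D : ℝ, (PGL2Geodesic.periodicOrbitsIn δ D).Finite) ∧
      ∃ c : ℝ, 0 < c ∧ ∃ D₀ : ℝ, ∀ D : ℝ, D₀ ≤ D →
        c * D ^ (1 - ε) ≤
          ∑ᶠ Y ∈ PGL2Geodesic.periodicOrbitsIn δ D, PGL2Geodesic.length Y := by
  -- Capping ε at 1/2 keeps s positive when ε is large.
  set s : ℝ := 1 - min ε (1 / 2) with hs
  have hε' : 0 < min ε (1 / 2) := lt_min hε (by norm_num)
  have hs0 : 0 < s := by linarith [min_le_right ε (1 / 2)]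
  have hs1 : s < 1 := by linarith
  have hsε : 1 - ε ≤ s := by linarith [min_le_left ε (1 / 2)]
  -- Possible because 2^(1-s) > 1 and the other factor tends to 1.
  obtain ⟨N, hN⟩ : ∃ N : ℕ, 1 ≤ (2 : ℝ) ^ (1 - s) * (1 - 2 / (N + 1)) := by
    set x := (2 : ℝ) ^ (1 - s)
    have hx : 1 < x := Real.one_lt_rpow one_lt_two (by linarith)
    obtain ⟨N, hN⟩ := exists_nat_gt (2 * x / (x - 1))
    refine ⟨N, ?_⟩
    rw [div_lt_iff₀ (by linarith)] at hN
    rw [mul_sub, mul_one, mul_div_assoc', le_sub_comm, div_le_iff₀ (by positivity)]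
    linarith
  set δ : ℝ := 1 / (6 * (N + 1) ^ 2)
  have hδ : 0 < δ := by positivity
  obtain ⟨K, hK, hmult⟩ := exists_card_le_length N
  -- A word with leading entry at most (N+1)R has trace at most 2(N+1)R, hence discriminant at most
  -- 5 (2(N+1)R)² = L R², which is D for R = √(D/L).
  set L : ℝ := 20 * (N + 1) ^ 2 with hL
  have hL0 : 0 < L := by positivity
  refine ⟨δ, hδ, isCompact_Omega hδ, finite_periodicOrbitsIn hδ, L ^ (-s) / K, by positivity,
    L + 1, fun D hD => ?_⟩
  have hD1 : 1 ≤ D := by linarith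
  set R := √(D / L)
  have hR2 : R ^ 2 = D / L := Real.sq_sqrt (by positivity)
  have hR : 1 ≤ R := Real.one_le_sqrt.2 (by rw [one_le_div hL0]; linarith)
  obtain ⟨S, hS, hSR, hsep, hcard⟩ := exists_separated_words hs0 hs1 hN hR
  have hdata : ∀ w, ∃ (α β : ℝ) (g : GL (Fin 2) ℝ), w ∈ S →
      (g : Matrix (Fin 2) (Fin 2) ℝ) = !![α, β; 1, 1] ∧
      1 < α ∧ α < N + 1 ∧ -1 < β ∧ β < 0 ∧ wordMobius w α = α ∧
      IsPeriodicOrbit (orbit (coset (ProjGenLinGroup.mk g))) ∧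
      orbit (coset (ProjGenLinGroup.mk g)) ⊆ Omega δ ∧
      (disc (orbit (coset (ProjGenLinGroup.mk g))) : ℤ) ≤ 5 * (wordMatrix w).trace ^ 2 := by
    intro w
    by_cases hw : w ∈ S
    · obtain ⟨α, β, g, h⟩ := orbit_word (hS w hw).1 (hS w hw).2
      exact ⟨α, β, g, fun _ => h⟩
    · exact ⟨0, 0, 1, fun h => absurd h hw⟩
  choose α β g hg using hdata
  set P := (finite_periodicOrbitsIn hδ D).toFinset
  set Φ : List ℕ → Set X := fun w => orbit (coset (ProjGenLinGroup.mk (g w)))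
  have hΦ : ∀ w ∈ S, Φ w ∈ P := by
    intro w hw
    obtain ⟨-, -, -, -, -, -, h1, h2, h3⟩ := hg w hw
    refine (Set.Finite.mem_toFinset _).2 ⟨h1, h2, ?_⟩
    have ht := wordMatrix_trace_le (hS w hw).1 (hS w hw).2
    have ht0 := wordMatrix_trace_pos (hS w hw).1
    have ht' : ((wordMatrix w).trace : ℝ) ≤ 2 * ((N + 1) * R) := by
      have : ((wordMatrix w).trace : ℝ) ≤ 2 * wordMatrix w 0 0 := by exact_mod_cast ht
      linarith [hSR w hw]
    have ht0' : (0 : ℝ) ≤ (wordMatrix w).trace := by exact_mod_cast zero_le_one.trans ht0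
    have h3' : (disc (Φ w) : ℝ) ≤ 5 * ((wordMatrix w).trace : ℝ) ^ 2 := by exact_mod_cast h3
    calc (disc (Φ w) : ℝ) ≤ 5 * ((wordMatrix w).trace : ℝ) ^ 2 := h3'
      _ ≤ 5 * (2 * ((N + 1) * R)) ^ 2 := by gcongr
      _ = L * R ^ 2 := by rw [hL]; ring
      _ = D := by rw [hR2]; field_simp
  have hfiber : ∀ Y ∈ P, ((S.filter fun w => Φ w = Y).card : ℝ) ≤ K * length Y := by
    intro Y hY
    refine hmult S α β g hsep (fun w hw => ?_) Y ((Set.Finite.mem_toFinset _).1 hY).1 _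
      (Finset.filter_subset _ _) fun w hw => (Finset.mem_filter.1 hw).2
    obtain ⟨h1, h2, h3, h4, h5, h6, -⟩ := hg w hw
    exact ⟨h1, h2, h3, h4, h5, h6⟩
  have hsum : (S.card : ℝ) ≤ K * ∑ Y ∈ P, length Y := by
    rw [Finset.card_eq_sum_card_fiberwise hΦ, Finset.mul_sum]
    push_cast
    exact Finset.sum_le_sum hfiber
  rw [finsum_mem_eq_finite_toFinset_sum _ (finite_periodicOrbitsIn hδ D), div_mul_eq_mul_div,
    div_le_iff₀ hK, mul_comm _ K]
  refine le_trans ?_ hsum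
  refine le_trans ?_ hcard
  rw [Real.rpow_mul (by positivity), Real.rpow_two, hR2, Real.div_rpow (by positivity) hL0.le,
    div_eq_mul_inv, ← Real.rpow_neg hL0.le, mul_comm]
  gcongr
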